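/- Let $\mathbb{H}$ be the quaternions, let $\mathbb{S}$ be the sphere of purely imaginary unit quaternions, and for $I\in\mathbb{S}$ let $\mathbb{C}_I=\{x+Iy : x,y\in\mathbb{R}\}$ with its area measure $dm_I$. A real differentiable function $f:\mathbb{H}\to\mathbb{H}$ is called entire (left) slice regular if $\frac12\left(\frac{\partial}{\partial x}+I\frac{\partial}{\partial y}\right)f(x+Iy)=0$ for all $I\in\mathbb{S}$ and all $x,y\in\mathbb{R}$. For $\alpha>0$, $0<p<\infty$ and $I\in\mathbb{S}$ put $$\|f\|_{p,\alpha,I}=\left(\frac{\alpha p}{2\pi}\int_{\mathbb{C}_I}|f(q)|^p\left(e^{-\alpha|q|^2/2}\right)^p\,dm_I(q)\right)^{1/p}\in[0,\infty].$$ The Fock space of the second kind $\mathcal{F}^{\alpha,p}_{Slice}(\mathbb{H})$ consists of all entire slice regular functions $f$ such that $\|f\|_{p,\alpha,I}<\infty$ for some $I\in\mathbb{S}$, and it is equipped with the norm (quasi-norm if $p<1$) $\|f\|_{\mathcal{F}^{\alpha,p}_{Slice}(\mathbb{H})}=\sup_{I\in\mathbb{S}}\|f\|_{p,\alpha,I}$.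 For $r,q\in\mathbb{H}$ let $$K_\alpha(r,q)=\sum_{k=0}^\infty\frac{\alpha^k r^k\overline{q}^{\,k}}{k!},$$ and let $\mathcal{R}$ be the set of all functions of the form $r\mapsto\sum_{k=1}^n K_\alpha(r,q_k)b_k$ with $n\in\mathbb{N}$ and $q_1,\dots,q_n,b_1,\dots,b_n\in\mathbb{H}$. **Theorem.** For all $\alpha>0$ and $0<p<\infty$, the set $\mathcal{R}$ is dense in $\mathcal{F}^{\alpha,p}_{Slice}(\mathbb{H})$. That is, $\mathcal{R}\subseteq\mathcal{F}^{\alpha,p}_{Slice}(\mathbb{H})$, and for every $f\in\mathcal{F}^{\alpha,p}_{Slice}(\mathbb{H})$ and every $\varepsilon>0$ there is $g\in\mathcal{R}$ with $\|f-g\|_{\mathcal{F}^{\alpha,p}_{Slice}(\mathbb{H})}<\varepsilon$. -/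

import Mathlib

open scoped Quaternion ENNReal
open MeasureTheory

noncomputable section

namespace SliceFock

/-- The sphere `𝕊` of purely imaginary unit quaternions. -/
def imagUnits : Set ℍ[ℝ] := {I | I.re = 0 ∧ ‖I‖ = 1}

/-- The point `x + I y` of the slice `ℂ_I = ℝ + I ℝ`. -/
def slicePoint (I : ℍ[ℝ]) (x y : ℝ) : ℍ[ℝ] := (x : ℍ[ℝ]) + I * (y : ℍ[ℝ])

/-- (Left) slice regular functions on a set `U` (meant for open `U`): `f` is real differentiable at
every point of `U` and, for every `I ∈ 𝕊`,
`½ (∂/∂x + I ∂/∂y) f (x + I y) = 0` at every `x + I y ∈ U`. -/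
def IsSliceRegularOn (f : ℍ[ℝ] → ℍ[ℝ]) (U : Set ℍ[ℝ]) : Prop :=
  (∀ q ∈ U, DifferentiableAt ℝ f q) ∧
    ∀ I ∈ imagUnits, ∀ x y : ℝ, slicePoint I x y ∈ U →
      (1 / 2 : ℝ) • (deriv (fun t : ℝ => f (slicePoint I t y)) x
        + I * deriv (fun t : ℝ => f (slicePoint I x t)) y) = 0

/-- The (quasi-)norm on the slice `ℂ_I`, with values in `[0, ∞]`:
`‖f‖_{p,α,I} = (αp/(2π) ∫_{ℂ_I} |f(q)|^p (e^{-α|q|²/2})^p dm_I(q))^{1/p}`.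
The area measure `dm_I` is transported from `ℂ` by `x + i y ↦ x + I y`. -/
def sliceNorm (α p : ℝ) (I : ℍ[ℝ]) (f : ℍ[ℝ] → ℍ[ℝ]) : ℝ≥0∞ :=
  (ENNReal.ofReal (α * p / (2 * Real.pi)) *
    ∫⁻ z : ℂ, ENNReal.ofReal
      (‖f (slicePoint I z.re z.im)‖ ^ p *
        Real.exp (-α * ‖slicePoint I z.re z.im‖ ^ 2 / 2) ^ p)) ^ (1 / p)

/-- The Fock space of the second kind: entire slice regular functions whose slice norm is finite
for some imaginary unit. -/
def fockSpace (α p : ℝ) : Set (ℍ[ℝ] → ℍ[ℝ]) :=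
  {f | IsSliceRegularOn f Set.univ ∧ ∃ I ∈ imagUnits, sliceNorm α p I f < ∞}

/-- The (quasi-)norm of the Fock space of the second kind: the supremum of the slice norms. -/
def fockNorm (α p : ℝ) (f : ℍ[ℝ] → ℍ[ℝ]) : ℝ≥0∞ :=
  ⨆ I ∈ imagUnits, sliceNorm α p I f

/-- The kernel `K_α(r, q) = ∑_k α^k r^k q̄^k / k!`. -/
def kernel (α : ℝ) (r q : ℍ[ℝ]) : ℍ[ℝ] :=
  ∑' k : ℕ, (α ^ k / (k.factorial : ℝ)) • (r ^ k * star q ^ k)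

/-- The series defining the kernel converges absolutely. -/
theorem summable_norm_kernel (α : ℝ) (r q : ℍ[ℝ]) :
    Summable fun k : ℕ => ‖(α ^ k / (k.factorial : ℝ)) • (r ^ k * star q ^ k)‖ := by
  refine (Real.summable_pow_div_factorial (|α| * (‖r‖ * ‖q‖))).congr fun k => ?_
  rw [norm_smul, norm_mul, norm_pow, norm_pow, norm_star, norm_div, norm_pow, Real.norm_eq_abs,
    Real.norm_natCast, mul_pow, mul_pow]
  ring

/-- The set `𝓡` of finite right-linear combinations `r ↦ ∑_k K_α(r, q_k) b_k`. -/
def kernelSpan (α : ℝ) : Set (ℍ[ℝ] → ℍ[ℝ]) :=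
  {f | ∃ (n : ℕ) (q b : Fin n → ℍ[ℝ]), f = fun r => ∑ k, kernel α r (q k) * b k}

end SliceFock

end

/-! Left multiplication by `ℂ_I` makes `ℍ` a complex Banach space in which a slice regular function,
restricted to `ℂ_I`, is an ordinary entire function. The representation formula expresses the values
on any slice through those at `z` and `conj z` on a fixed slice, so Gaussian moments on different
slices are comparable with a uniform constant (`IsSliceRegularOn.fockMoment_sliceHom_le`). Hence
approximation on one slice gives approximation in the supremum over all slices.

On one slice, polynomials are dense (`exists_polynomial_fockMoment_sub_lt`). Dilations `h(r·)` tend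
to `h` as `r → 1`, by a Fatou argument. A local `L^p` estimate gives `h` growth of order
`exp(α(‖z‖+1)²/2)`; dilation makes this strictly subcritical, and Cauchy's estimates then dominate
all Taylor polynomials of `h(r·)` by one integrable Gaussian.

Monomials are limits of kernel combinations (`exists_kernelSpan_monomial`). At a real node `t` the
kernel is `e^{αtz}`, so the `n`-th power of the difference quotient `(e^{αsz} - 1)/(αs)` is a
combination with nodes `0, s, …, ns`. It tends to `z^n` as `s → 0`, with a bound of exponential
type.

Errors are measured by `p`-th moments rather than norms: their quasi-triangle inequality with
constant `2^p` holds for every `p > 0`, so `p ≤ 1` and `p ≥ 1` are separated only in the local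
estimate. -/

namespace SliceFock

open Filter Topology Metric

/-! ### Banach-valued entire functions: Taylor series and local `L^p` estimates -/

section Banach

variable {E : Type*} [NormedAddCommGroup E] [NormedSpace ℂ E] [CompleteSpace E]

theorem enorm_mul_le_lintegral_circleMap {h : ℂ → E} (hh : Differentiable ℂ h) (c : ℂ) (r : ℝ) :
    ENNReal.ofReal (2 * Real.pi) * ‖h c‖ₑ ≤
      ∫⁻ θ in Set.Ioo (-Real.pi) Real.pi, ‖h (circleMap c r θ)‖ₑ := by
  have hmv : Real.circleAverage h c r = h c := DiffContOnCl.circleAverage hh.diffContOnCl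
  rw [Real.circleAverage_def] at hmv
  have hper : Function.Periodic (fun θ => h (circleMap c r θ)) (2 * Real.pi) := fun θ => by
    simp [periodic_circleMap c r θ]
  have hint : ∫ θ in (0)..(2 * Real.pi), h (circleMap c r θ)
      = ∫ θ in Set.Ioo (-Real.pi) Real.pi, h (circleMap c r θ) := by
    have := hper.intervalIntegral_add_eq 0 (-Real.pi)
    rw [zero_add] at this
    rw [this, intervalIntegral.integral_of_le (by linarith [Real.pi_pos]),
      show -Real.pi + 2 * Real.pi = Real.pi by ring, integral_Ioc_eq_integral_Ioo]
  have h2 : ‖∫ θ in Set.Ioo (-Real.pi) Real.pi, h (circleMap c r θ)‖ₑ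
      ≤ ∫⁻ θ in Set.Ioo (-Real.pi) Real.pi, ‖h (circleMap c r θ)‖ₑ :=
    enorm_integral_le_lintegral_enorm _
  refine le_trans (le_of_eq ?_) h2
  rw [← hint, ← hmv]
  set v := ∫ θ in (0)..(2 * Real.pi), h (circleMap c r θ)
  rw [enorm_smul, ← mul_assoc, Real.enorm_eq_ofReal (by positivity),
    ← ENNReal.ofReal_mul (by positivity), mul_inv_cancel₀ (by positivity)]
  simp

/-- Polar coordinates around `c` reduce this to the circle estimate, integrated against `r dr` over
`(0, δ)`. -/
theorem enorm_mul_le_setLIntegral_ball {h : ℂ → E} (hh : Differentiable ℂ h) (c : ℂ) {δ : ℝ}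
    (hδ : 0 < δ) :
    ENNReal.ofReal (Real.pi * δ ^ 2) * ‖h c‖ₑ ≤ ∫⁻ w in ball c δ, ‖h w‖ₑ := by
  have hcont := hh.continuous
  have h1 : ∫⁻ w in ball c δ, ‖h w‖ₑ
      = ∫⁻ w : ℂ, (ball (0 : ℂ) δ).indicator (fun w => ‖h (c + w)‖ₑ) w := by
    rw [← lintegral_indicator measurableSet_ball,
      ← lintegral_add_left_eq_self _ c]
    refine lintegral_congr fun w => ?_
    simp [Set.indicator, dist_eq_norm]
  rw [h1, ← Complex.lintegral_comp_polarCoord_symm, polarCoord_target,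
    Measure.volume_eq_prod, ← Measure.prod_restrict]
  have h2 : ∀ q : ℝ × ℝ, q.1 ∈ Set.Ioi (0:ℝ) →
      ENNReal.ofReal q.1 • (ball (0 : ℂ) δ).indicator (fun w => ‖h (c + w)‖ₑ)
        (Complex.polarCoord.symm q)
      = (Set.Iio δ).indicator (fun r => ENNReal.ofReal r) q.1 * ‖h (circleMap c q.1 q.2)‖ₑ := by
    rintro ⟨r, θ⟩ hr
    have hr' : (0:ℝ) < r := hr
    have h3 : Complex.polarCoord.symm (r, θ) = r * Complex.exp (θ * Complex.I) := by
      rw [Complex.polarCoord_symm_apply, Complex.exp_mul_I]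
      simp
    have h4 : ‖(r : ℂ) * Complex.exp (θ * Complex.I)‖ = r := by
      simp [Complex.norm_exp_ofReal_mul_I, abs_of_pos hr']
    rw [h3]
    by_cases hrδ : r < δ
    · simp [Set.indicator, Complex.norm_exp_ofReal_mul_I, abs_of_pos hr', hrδ, circleMap]
    · simp [Set.indicator, Complex.norm_exp_ofReal_mul_I, abs_of_pos hr', hrδ]
  have h3 : ∫⁻ q : ℝ × ℝ, ENNReal.ofReal q.1 • (ball (0 : ℂ) δ).indicator
        (fun w => ‖h (c + w)‖ₑ) (Complex.polarCoord.symm q)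
          ∂((volume.restrict (Set.Ioi (0:ℝ))).prod (volume.restrict (Set.Ioo (-Real.pi) Real.pi)))
      = ∫⁻ q : ℝ × ℝ, (Set.Iio δ).indicator (fun r => ENNReal.ofReal r) q.1
          * ‖h (circleMap c q.1 q.2)‖ₑ
          ∂((volume.restrict (Set.Ioi (0:ℝ))).prod
            (volume.restrict (Set.Ioo (-Real.pi) Real.pi))) := by
    rw [Measure.prod_restrict]
    refine setLIntegral_congr_fun (measurableSet_Ioi.prod measurableSet_Ioo) fun q hq => ?_
    exact h2 q hq.1
  have hmeas : Measurable fun q : ℝ × ℝ => (Set.Iio δ).indicator (fun r => ENNReal.ofReal r) q.1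
          * ‖h (circleMap c q.1 q.2)‖ₑ := by
    refine Measurable.mul ?_ ?_
    · exact (ENNReal.measurable_ofReal.indicator measurableSet_Iio).comp measurable_fst
    · have : Continuous fun q : ℝ × ℝ => h (circleMap c q.1 q.2) := by
        unfold circleMap
        fun_prop
      exact this.enorm.measurable
  rw [h3, lintegral_prod _ hmeas.aemeasurable]
  have h5 : ∫⁻ r in Set.Ioi (0:ℝ), (Set.Iio δ).indicator (fun r => ENNReal.ofReal r) r
      = ENNReal.ofReal (δ ^ 2 / 2) := by
    rw [lintegral_indicator measurableSet_Iio, Measure.restrict_restrict measurableSet_Iio,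
      Set.inter_comm, Set.Ioi_inter_Iio, ← ofReal_integral_eq_lintegral_ofReal]
    · rw [← integral_Ioc_eq_integral_Ioo, ← intervalIntegral.integral_of_le hδ.le]
      simp
    · exact (continuous_id.integrableOn_Icc (a := 0) (b := δ)).mono_set Set.Ioo_subset_Icc_self
    · filter_upwards [ae_restrict_mem measurableSet_Ioo] with r hr using hr.1.le
  calc ENNReal.ofReal (Real.pi * δ ^ 2) * ‖h c‖ₑ
      = ∫⁻ r in Set.Ioi (0:ℝ), (Set.Iio δ).indicator (fun r => ENNReal.ofReal r) r *
          (ENNReal.ofReal (2 * Real.pi) * ‖h c‖ₑ) := by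
        rw [lintegral_mul_const' _ _ (by finiteness), h5, ← mul_assoc,
          ← ENNReal.ofReal_mul (by positivity)]
        congr 2; ring
    _ ≤ _ := by
        refine lintegral_mono fun r => ?_
        dsimp only
        rw [lintegral_const_mul']
        · gcongr
          exact enorm_mul_le_lintegral_circleMap hh c r
        · simp only [Set.indicator]; split_ifs <;> simp

/-- Taylor expansion of an entire function at the origin together with Cauchy's estimates. -/
theorem exists_hasSum_pow_smul {h : ℂ → E} (hh : Differentiable ℂ h) :
    ∃ a : ℕ → E, (∀ z, HasSum (fun n => z ^ n • a n) (h z)) ∧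
      ∀ (R M : ℝ), 0 ≤ R → (∀ w, ‖w‖ = R → ‖h w‖ ≤ M) → ∀ n, ‖a n‖ * R ^ n ≤ M := by
  have hs : ∀ z, HasSum (fun n : ℕ => z ^ n • ((n.factorial : ℂ)⁻¹ • iteratedDeriv n h 0)) (h z) := by
    intro z
    have := Complex.hasSum_taylorSeries_of_entire hh 0 z
    refine this.congr_fun fun n => ?_
    simp [smul_smul, mul_comm]
  refine ⟨_, hs, fun R M hR hM n => ?_⟩
  -- Radius `0` is needed because the estimate is later applied on circles of radius `s * ‖z‖`,
  -- including `z = 0`.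
  rcases hR.eq_or_lt with rfl | hR
  · have h0 := hM 0 (by simp)
    rcases Nat.eq_zero_or_pos n with rfl | hn
    · simpa using h0
    · simpa [hn.ne'] using (norm_nonneg _).trans h0
  · have := Complex.norm_iteratedDeriv_le_of_forall_mem_sphere_norm_le (c := 0) n hR
      (f := h) (C := M) hh.diffContOnCl (fun w hw => hM w (by simpa using hw))
    rw [norm_smul, norm_inv, Complex.norm_natCast]
    calc _ ≤ ((n.factorial : ℝ)⁻¹ * (n.factorial * M / R ^ n)) * R ^ n := by gcongr
      _ = M := by field_simp

theorem differentiable_tsum_pow_smul {a : ℕ → E} (ha : ∀ R : ℝ, Summable fun n => ‖a n‖ * R ^ n) :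
    Differentiable ℂ fun z : ℂ => ∑' n, z ^ n • a n := by
  intro z
  have := Complex.differentiableOn_tsum_of_summable_norm (ι := ℕ) (U := ball (0 : ℂ) (‖z‖ + 1))
    (F := fun n (z : ℂ) => z ^ n • a n) (ha (‖z‖ + 1)) (fun n => by fun_prop) isOpen_ball
    (fun n w hw => by
      rw [norm_smul, norm_pow, mul_comm]
      have : ‖w‖ < ‖z‖ + 1 := by simpa using hw
      gcongr)
  exact this.differentiableAt (isOpen_ball.mem_nhds (by simp))

/-- A maximum argument replaces subharmonicity of `‖h‖^p`. Near a maximiser of `‖h‖` times a power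
of the distance to the boundary, `‖h‖` is at most a multiple of its central value, so `‖h‖ ≤ T^(1-p)
‖h‖^p` there and the `L¹` estimate applies. -/
theorem norm_rpow_le_setLIntegral_ball_of_le_one {p : ℝ} (hp : 0 < p) (hp1 : p ≤ 1) {h : ℂ → E}
    (hh : Differentiable ℂ h) (c : ℂ) :
    ‖h c‖ₑ ^ p ≤ ENNReal.ofReal (2 ^ (2 / p) / Real.pi) * ∫⁻ w in ball c 1, ‖h w‖ₑ ^ p := by
  set B := ∫⁻ w in ball c 1, ‖h w‖ₑ ^ p with hB
  by_cases hBtop : B = ⊤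
  · rw [hBtop, ENNReal.mul_top (by simp; positivity)]
    exact le_top
  have hcont := hh.continuous
  -- The exponent `2 / p` is chosen so that the `p`-th power of the weight is an area, cancelling
  -- the `δ ^ 2` of the mean value inequality. Only values on the closed unit disc matter.
  let u : ℂ → ℝ := fun z => ‖h z‖ * (1 - ‖z - c‖) ^ (2 / p)
  have hu : Continuous u :=
    hcont.norm.mul (Continuous.rpow_const (by fun_prop) fun _ => Or.inr (by positivity))
  obtain ⟨z₀, hz₀, hmax⟩ := (isCompact_closedBall c 1).exists_isMaxOn
    ⟨c, mem_closedBall_self zero_le_one⟩ hu.continuousOn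
  have hcS : ‖h c‖ ≤ u z₀ := by
    simpa [u] using hmax (mem_closedBall_self zero_le_one : c ∈ closedBall c 1)
  have hmain : Real.pi * u z₀ ^ p ≤ 2 ^ (2 / p) * B.toReal := by
    have hz₀' : ‖z₀ - c‖ ≤ 1 := by simpa [dist_eq_norm] using hz₀
    rcases (norm_nonneg _ |>.trans hcS).eq_or_lt with hS | hS
    · rw [← hS, Real.zero_rpow hp.ne', mul_zero]
      positivity
    have hd : 0 < 1 - ‖z₀ - c‖ := by
      refine lt_of_le_of_ne (by linarith) fun h0 => hS.ne' ?_
      simp only [u]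
      rw [← h0, Real.zero_rpow (by positivity), mul_zero]
    obtain ⟨δ, hδd⟩ : ∃ δ, δ = (1 - ‖z₀ - c‖) / 2 := ⟨_, rfl⟩
    have hδ : 0 < δ := by rw [hδd]; positivity
    have hSdef : u z₀ = ‖h z₀‖ * (2 ^ (2 / p) * δ ^ (2 / p)) := by
      simp only [u]
      rw [show 1 - ‖z₀ - c‖ = 2 * δ by linarith, Real.mul_rpow (by norm_num) hδ.le]
    obtain ⟨S, hSS⟩ : ∃ S, S = u z₀ := ⟨_, rfl⟩
    rw [← hSS] at hS hSdef ⊢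
    have hδp : 0 < δ ^ (2 / p) := by positivity
    -- `T` bounds `‖h‖` on `ball z₀ δ`, since points there stay at distance at least `δ` from the
    -- unit circle around `c`.
    obtain ⟨T, hT⟩ : ∃ T, T = S / δ ^ (2 / p) := ⟨_, rfl⟩
    have hT0 : 0 < T := by rw [hT]; positivity
    have hle : ∀ w ∈ ball z₀ δ, w ∈ ball c 1 ∧ ‖h w‖ ≤ T := by
      intro w hw
      have hw1 : ‖w - z₀‖ < δ := by simpa [dist_eq_norm] using hw
      have hw2 : ‖w - c‖ < 1 - δ := by
        calc ‖w - c‖ ≤ ‖w - z₀‖ + ‖z₀ - c‖ := norm_sub_le_norm_sub_add_norm_sub _ _ _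
          _ < 1 - δ := by linarith
      have hwc : w ∈ ball c 1 := by
        rw [mem_ball, dist_eq_norm]; linarith
      refine ⟨hwc, ?_⟩
      have h1 : u w ≤ u z₀ := hmax (ball_subset_closedBall hwc)
      rw [hT, le_div_iff₀ hδp, hSS]
      refine le_trans ?_ h1
      simp only [u]
      gcongr
      linarith
    have h2 : ∫⁻ w in ball z₀ δ, ‖h w‖ₑ ≤ ENNReal.ofReal (T ^ (1 - p)) * B := by
      calc ∫⁻ w in ball z₀ δ, ‖h w‖ₑ
          ≤ ∫⁻ w in ball z₀ δ, ENNReal.ofReal (T ^ (1 - p)) * ‖h w‖ₑ ^ p := by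
            refine setLIntegral_mono' measurableSet_ball fun w hw => ?_
            have hw := (hle w hw).2
            rw [← ofReal_norm, ENNReal.ofReal_rpow_of_nonneg (norm_nonneg _) hp.le,
              ← ENNReal.ofReal_mul (by positivity)]
            refine ENNReal.ofReal_le_ofReal ?_
            calc ‖h w‖ = ‖h w‖ ^ (1 - p) * ‖h w‖ ^ p := by
                  rw [← Real.rpow_add' (norm_nonneg _) (by simp)]; simp
              _ ≤ _ := by
                  gcongr
        _ = ENNReal.ofReal (T ^ (1 - p)) * ∫⁻ w in ball z₀ δ, ‖h w‖ₑ ^ p :=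
            lintegral_const_mul' _ _ (by finiteness)
        _ ≤ _ := by
            gcongr
            exact lintegral_mono_set fun w hw => (hle w hw).1
    have h3 := (enorm_mul_le_setLIntegral_ball hh z₀ hδ).trans h2
    rw [← ENNReal.ofReal_toReal hBtop, ← ofReal_norm, ← ENNReal.ofReal_mul (by positivity),
      ← ENNReal.ofReal_mul (by positivity), ENNReal.ofReal_le_ofReal_iff (by positivity)] at h3
    have hTz : ‖h z₀‖ = T / 2 ^ (2 / p) := by
      rw [hT, hSdef]; field_simp
    have hTS : δ ^ 2 * T ^ p = S ^ p := by
      rw [hT, Real.div_rpow hS.le hδp.le, ← Real.rpow_mul hδ.le, div_mul_cancel₀ _ hp.ne',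
        Real.rpow_two]
      field_simp
    have hTT : T = T ^ (1 - p) * T ^ p := by
      rw [← Real.rpow_add hT0]; simp
    rw [hTz] at h3
    have hq : (0:ℝ) < 2 ^ (2 / p) := by positivity
    have hT1 : 0 < T ^ (1 - p) := by positivity
    have h4 : T ^ (1 - p) * (Real.pi * (δ ^ 2 * T ^ p)) ≤ T ^ (1 - p) * (2 ^ (2 / p) * B.toReal) := by
      calc T ^ (1 - p) * (Real.pi * (δ ^ 2 * T ^ p))
          = (Real.pi * δ ^ 2 * (T ^ (1 - p) * T ^ p / 2 ^ (2 / p))) * 2 ^ (2 / p) := by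
            field_simp
        _ ≤ (T ^ (1 - p) * B.toReal) * 2 ^ (2 / p) := by
            rw [← hTT]; gcongr
        _ = _ := by ring
    rw [hTS] at h4
    exact le_of_mul_le_mul_left h4 hT1
  rw [← ENNReal.ofReal_toReal hBtop, ← ofReal_norm,
    ENNReal.ofReal_rpow_of_nonneg (norm_nonneg _) hp.le, ← ENNReal.ofReal_mul (by positivity)]
  refine ENNReal.ofReal_le_ofReal ?_
  calc ‖h c‖ ^ p ≤ u z₀ ^ p := by gcongr
    _ ≤ _ := by
      rw [div_mul_eq_mul_div, le_div_iff₀ Real.pi_pos]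
      linarith

theorem norm_rpow_le_setLIntegral_ball_of_one_le {p : ℝ} (hp1 : 1 ≤ p) {h : ℂ → E}
    (hh : Differentiable ℂ h) (c : ℂ) :
    ‖h c‖ₑ ^ p ≤ ∫⁻ w in ball c 1, ‖h w‖ₑ ^ p := by
  have hp : 0 < p := by linarith
  have hv : volume.restrict (ball c 1) Set.univ = ENNReal.ofReal Real.pi := by
    rw [Measure.restrict_apply_univ, Complex.volume_ball]
    simp [← NNReal.coe_real_pi]
  have h1 := eLpNorm_le_eLpNorm_mul_rpow_measure_univ (μ := volume.restrict (ball c 1))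
    (p := 1) (q := ENNReal.ofReal p) (f := h) (by simpa using hp1)
    hh.continuous.aestronglyMeasurable
  rw [eLpNorm_one_eq_lintegral_enorm, eLpNorm_eq_lintegral_rpow_enorm_toReal (by simpa using hp)
    (by simp), hv, ENNReal.toReal_ofReal hp.le] at h1
  have h2 := (enorm_mul_le_setLIntegral_ball hh c one_pos).trans h1
  set B := ∫⁻ w in ball c 1, ‖h w‖ₑ ^ p
  have h3 : ENNReal.ofReal Real.pi * ‖h c‖ₑ ≤ ENNReal.ofReal Real.pi * B ^ (1 / p) := by
    -- Hölder produces `π^(1 - 1/p)`. As `π ≥ 1` this is at most `π`, which cancels against the area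
    -- on the left.
    have h5 : ENNReal.ofReal Real.pi ^ (1 / ENNReal.toReal 1 - 1 / p) ≤ ENNReal.ofReal Real.pi := by
      refine (ENNReal.rpow_le_rpow_of_exponent_le (z := 1) ?_ ?_).trans_eq (ENNReal.rpow_one _)
      · rw [ENNReal.one_le_ofReal]; linarith [Real.pi_gt_three]
      · simp; positivity
    rw [one_pow, mul_one] at h2
    calc _ ≤ _ := h2
      _ ≤ B ^ (1 / p) * ENNReal.ofReal Real.pi := by gcongr
      _ = _ := mul_comm _ _
  have h4 : ‖h c‖ₑ ≤ B ^ (1 / p) :=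
    (ENNReal.mul_le_mul_iff_right (by simpa using Real.pi_pos) (by finiteness)).1 h3
  calc ‖h c‖ₑ ^ p ≤ (B ^ (1 / p)) ^ p := by gcongr
    _ = B := by rw [← ENNReal.rpow_mul]; simp [hp.ne']

/-- Local `L^p` norms control point values of entire functions, for every `p > 0`. -/
theorem exists_norm_rpow_le_setLIntegral_ball {p : ℝ} (hp : 0 < p) :
    ∃ K : ℝ, ∀ {h : ℂ → E}, Differentiable ℂ h → ∀ c : ℂ,
      ‖h c‖ₑ ^ p ≤ ENNReal.ofReal K * ∫⁻ w in ball c 1, ‖h w‖ₑ ^ p := by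
  rcases le_total p 1 with hp1 | hp1
  · exact ⟨_, fun hh c => norm_rpow_le_setLIntegral_ball_of_le_one hp hp1 hh c⟩
  · exact ⟨1, fun hh c => by simpa using norm_rpow_le_setLIntegral_ball_of_one_le hp1 hh c⟩

end Banach

/-- The Gaussian weight `e^{-αp|z|²/2}` on the complex plane. -/
noncomputable def gaussianWeight (α p : ℝ) (z : ℂ) : ℝ≥0∞ :=
  ENNReal.ofReal (Real.exp (-(α * p / 2) * ‖z‖ ^ 2))

theorem continuous_gaussianWeight (α p : ℝ) : Continuous (gaussianWeight α p) := by
  unfold gaussianWeight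
  exact ENNReal.continuous_ofReal.comp (by fun_prop)

theorem gaussianWeight_ne_top (α p : ℝ) (z : ℂ) : gaussianWeight α p z ≠ ∞ :=
  ENNReal.ofReal_ne_top

/-! ### Gaussian moments: quasi-triangle inequality, domination, dilation -/

section Moment

variable {E : Type*} [NormedAddCommGroup E]

/-- The `p`-th absolute moment of `h` against the Gaussian weight. -/
noncomputable def fockMoment (α p : ℝ) (h : ℂ → E) : ℝ≥0∞ := ∫⁻ z, ‖h z‖ₑ ^ p * gaussianWeight α p z

theorem add_rpow_le_two_rpow_mul {p : ℝ} (hp : 0 ≤ p) (a b : ℝ≥0∞) :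
    (a + b) ^ p ≤ 2 ^ p * (a ^ p + b ^ p) := by
  calc (a + b) ^ p ≤ (2 * max a b) ^ p := by
        gcongr
        rw [two_mul]
        gcongr
        · exact le_max_left _ _
        · exact le_max_right _ _
    _ = 2 ^ p * max a b ^ p := ENNReal.mul_rpow_of_nonneg _ _ hp
    _ ≤ _ := by
        gcongr
        rcases max_choice a b with h | h <;> rw [h]
        · exact le_self_add
        · exact le_add_self

theorem measurable_fockMoment_integrand (α p : ℝ) {h : ℂ → E} (hh : Continuous h) :
    Measurable fun z => ‖h z‖ₑ ^ p * gaussianWeight α p z :=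
  (hh.enorm.measurable.pow_const p).mul (continuous_gaussianWeight α p).measurable

/-- Stated for a pointwise bound rather than a sum, so that it also serves the comparison of slices.
-/
theorem fockMoment_le_of_enorm_le {F G : Type*} [NormedAddCommGroup F] [NormedAddCommGroup G]
    (α : ℝ) {p : ℝ} (hp : 0 ≤ p) {h : ℂ → E} {u : ℂ → F} {v : ℂ → G}
    (hu : Continuous u) (huv : ∀ z, ‖h z‖ₑ ≤ ‖u z‖ₑ + ‖v z‖ₑ) :
    fockMoment α p h ≤ 2 ^ p * (fockMoment α p u + fockMoment α p v) := by
  unfold fockMoment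
  rw [← lintegral_add_left (measurable_fockMoment_integrand α p hu),
    ← lintegral_const_mul' _ _ (by finiteness)]
  refine lintegral_mono fun z => ?_
  rw [← add_mul, ← mul_assoc]
  gcongr
  exact (by gcongr; exact huv z : _ ≤ (‖u z‖ₑ + ‖v z‖ₑ) ^ p).trans (add_rpow_le_two_rpow_mul hp _ _)

theorem fockMoment_add_le (α : ℝ) {p : ℝ} (hp : 0 ≤ p) {u v : ℂ → E} (hu : Continuous u) :
    fockMoment α p (u + v) ≤ 2 ^ p * (fockMoment α p u + fockMoment α p v) :=
  fockMoment_le_of_enorm_le α hp hu fun z => enorm_add_le (u z) (v z)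

theorem exists_pos_two_rpow_mul_add_le (p : ℝ) {δ : ℝ≥0∞} (hδ : 0 < δ) :
    ∃ η : ℝ≥0∞, 0 < η ∧ 2 ^ p * (η + η) ≤ δ := by
  have hK : (2 : ℝ≥0∞) ^ p ≠ 0 := by simp
  have hK' : (2 : ℝ≥0∞) ^ p ≠ ∞ := by finiteness
  refine ⟨δ / 2 ^ p / 2, ENNReal.half_pos (ENNReal.div_pos hδ.ne' hK').ne', ?_⟩
  rw [ENNReal.add_halves, ENNReal.mul_div_cancel hK hK']

theorem fockMoment_add_lt {α p : ℝ} (hp : 0 ≤ p) {u v : ℂ → E} (hu : Continuous u)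
    {η δ : ℝ≥0∞} (hηδ : 2 ^ p * (η + η) ≤ δ) (hu' : fockMoment α p u < η)
    (hv' : fockMoment α p v < η) : fockMoment α p (u + v) < δ := by
  refine (fockMoment_add_le α hp hu).trans_lt (lt_of_lt_of_le ?_ hηδ)
  exact (ENNReal.mul_lt_mul_iff_right (by simp) (by finiteness)).2 (ENNReal.add_lt_add hu' hv')

/-- Growth at rate `β` leaves a Gaussian of rate `(α - β) p / 2`, which is integrable once `β < α`.
-/
theorem enorm_rpow_mul_gaussianWeight_le {α β p C : ℝ} (hp : 0 ≤ p) (hC : 0 ≤ C) {z : ℂ} {v : E}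
    (hv : ‖v‖ ≤ C * Real.exp (β / 2 * ‖z‖ ^ 2)) :
    ‖v‖ₑ ^ p * gaussianWeight α p z ≤
      ENNReal.ofReal (C ^ p * Real.exp (-((α - β) * p / 2) * ‖z‖ ^ 2)) := by
  rw [gaussianWeight, ← ofReal_norm, ENNReal.ofReal_rpow_of_nonneg (norm_nonneg _) hp,
    ← ENNReal.ofReal_mul (by positivity)]
  refine ENNReal.ofReal_le_ofReal ?_
  calc ‖v‖ ^ p * Real.exp (-(α * p / 2) * ‖z‖ ^ 2)
      ≤ (C * Real.exp (β / 2 * ‖z‖ ^ 2)) ^ p * Real.exp (-(α * p / 2) * ‖z‖ ^ 2) := by gcongr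
    _ = _ := by
      rw [Real.mul_rpow hC (Real.exp_nonneg _), ← Real.exp_mul, mul_assoc, ← Real.exp_add]
      ring_nf

theorem lintegral_gaussian_ne_top {b : ℝ} (hb : 0 < b) (C : ℝ) :
    ∫⁻ z : ℂ, ENNReal.ofReal (C * Real.exp (-b * ‖z‖ ^ 2)) ≠ ∞ := by
  have h1 := GaussianFourier.integrable_cexp_neg_mul_sq_norm_add (V := ℂ) (b := b) (by simpa) 0 0
  have h2 : Integrable fun z : ℂ => Real.exp (-b * ‖z‖ ^ 2) := by
    refine h1.norm.congr (ae_of_all _ fun z => ?_)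
    simp only [Complex.norm_exp]
    simp [← Complex.ofReal_pow]
  exact (h2.const_mul C).lintegral_lt_top.ne

theorem fockMoment_ne_top_of_norm_le {α β p C : ℝ} (hβ : β < α) (hp : 0 < p) (hC : 0 ≤ C)
    {h : ℂ → E} (hh : ∀ z, ‖h z‖ ≤ C * Real.exp (β / 2 * ‖z‖ ^ 2)) : fockMoment α p h ≠ ∞ := by
  refine ne_top_of_le_ne_top (lintegral_gaussian_ne_top (b := (α - β) * p / 2) ?_ (C ^ p))
    (lintegral_mono fun z => enorm_rpow_mul_gaussianWeight_le hp.le hC (hh z))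
  have := sub_pos.2 hβ
  positivity

/-- Dominated convergence for Gaussian moments. -/
theorem tendsto_fockMoment_sub_of_norm_le {α β p C : ℝ} (hβ : β < α) (hp : 0 < p) (hC : 0 ≤ C)
    {u : ℕ → ℂ → E} {h : ℂ → E} (hu : ∀ n, Continuous (u n)) (hh : Continuous h)
    (hbound : ∀ n z, ‖u n z‖ ≤ C * Real.exp (β / 2 * ‖z‖ ^ 2))
    (hlim : ∀ z, Tendsto (fun n => u n z) atTop (𝓝 (h z))) :
    Tendsto (fun n => fockMoment α p (h - u n)) atTop (𝓝 0) := by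
  have hbh : ∀ z, ‖h z‖ ≤ C * Real.exp (β / 2 * ‖z‖ ^ 2) := fun z =>
    le_of_tendsto (hlim z).norm (Eventually.of_forall fun n => hbound n z)
  have hαβ := sub_pos.2 hβ
  have := tendsto_lintegral_of_dominated_convergence
    (F := fun n z => ‖(h - u n) z‖ₑ ^ p * gaussianWeight α p z) (f := fun _ => 0)
    (fun z => ENNReal.ofReal ((2 * C) ^ p * Real.exp (-((α - β) * p / 2) * ‖z‖ ^ 2)))
    (fun n => measurable_fockMoment_integrand α p (hh.sub (hu n)))
    (fun n => ae_of_all _ fun z => enorm_rpow_mul_gaussianWeight_le hp.le (by positivity) ?_)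
    (lintegral_gaussian_ne_top (by positivity) _) (ae_of_all _ fun z => ?_)
  · simpa [fockMoment] using this
  · calc ‖h z - u n z‖ ≤ ‖h z‖ + ‖u n z‖ := norm_sub_le _ _
      _ ≤ _ := by linarith [hbh z, hbound n z]
  · have h1 : Tendsto (fun n => ‖(h - u n) z‖ₑ) atTop (𝓝 0) := by
      have : Tendsto (fun n => h z - u n z) atTop (𝓝 0) := by
        simpa using (tendsto_const_nhds (x := h z)).sub (hlim z)
      simpa using this.enorm
    have h2 : Tendsto (fun n => ‖(h - u n) z‖ₑ ^ p) atTop (𝓝 0) := by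
      simpa [hp, Function.comp_def] using
        (ENNReal.continuous_rpow_const (y := p)).tendsto 0 |>.comp h1
    simpa using ENNReal.Tendsto.mul_const h2 (Or.inr (gaussianWeight_ne_top α p z))

/-- Dilation by `r ≤ 1` changes Gaussian moments by a factor at most `r⁻²`. -/
theorem fockMoment_comp_smul_le {α p : ℝ} (hα : 0 ≤ α) (hp : 0 ≤ p) {h : ℂ → E} (hh : Continuous h)
    {r : ℝ} (hr : 0 < r) (hr1 : r ≤ 1) :
    fockMoment α p (fun z => h (r • z)) ≤ ENNReal.ofReal (r ^ 2)⁻¹ * fockMoment α p h := by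
  have h1 : ∀ z, ‖h (r • z)‖ₑ ^ p * gaussianWeight α p z
      ≤ (fun w => ‖h w‖ₑ ^ p * gaussianWeight α p w) (r • z) := fun z => by
    dsimp only
    gcongr
    refine ENNReal.ofReal_le_ofReal (Real.exp_le_exp.2 ?_)
    have : ‖r • z‖ ≤ ‖z‖ := by
      rw [norm_smul, Real.norm_of_nonneg hr.le]
      exact mul_le_of_le_one_left (norm_nonneg _) hr1
    have h2 : ‖r • z‖ ^ 2 ≤ ‖z‖ ^ 2 := by gcongr
    have h3 : 0 ≤ α * p / 2 := by positivity
    nlinarith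
  refine (lintegral_mono h1).trans_eq ?_
  have h2 := Measure.map_addHaar_smul (volume : Measure ℂ) hr.ne'
  rw [← lintegral_map (measurable_fockMoment_integrand α p hh) (measurable_const_smul r), h2,
    lintegral_smul_measure, fockMoment, Complex.finrank_real_complex, abs_of_pos (by positivity)]
  rfl

/-- Dilations converge to the identity in Gaussian moments. -/
theorem tendsto_fockMoment_sub_comp_smul {α p : ℝ} (hα : 0 ≤ α) (hp : 0 < p) {h : ℂ → E}
    (hh : Continuous h) (hM : fockMoment α p h ≠ ∞) {r : ℕ → ℝ} (hr : ∀ n, 0 < r n)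
    (hr1 : ∀ n, r n ≤ 1) (hlim : Tendsto r atTop (𝓝 1)) :
    Tendsto (fun n => fockMoment α p (h - fun z => h (r n • z))) atTop (𝓝 0) := by
  let D : ℕ → ℂ → ℝ≥0∞ := fun n z => ‖(h - fun z => h (r n • z)) z‖ₑ ^ p * gaussianWeight α p z
  -- No fixed majorant of the `D n` is available. The varying majorants `G n` suffice because the
  -- upper bounds for their integrals converge to the integral of their pointwise limit.
  let G : ℕ → ℂ → ℝ≥0∞ := fun n z =>
    2 ^ p * (‖h z‖ₑ ^ p * gaussianWeight α p z + ‖h (r n • z)‖ₑ ^ p * gaussianWeight α p z)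
  set M := fockMoment α p h
  have hcont : ∀ n, Continuous fun z => h (r n • z) := fun n => by fun_prop
  have hDmeas : ∀ n, Measurable (D n) := fun n =>
    measurable_fockMoment_integrand α p (hh.sub (hcont n))
  have hGmeas : ∀ n, Measurable (G n) := fun n =>
    ((measurable_fockMoment_integrand α p hh).add
      (measurable_fockMoment_integrand α p (hcont n))).const_mul _
  have hDG : ∀ n z, D n z ≤ G n z := fun n z => by
    simp only [D, G]
    rw [← add_mul, ← mul_assoc]
    gcongr
    refine le_trans ?_ (add_rpow_le_two_rpow_mul hp.le _ _)
    gcongr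
    exact enorm_sub_le
  have hwt := gaussianWeight_ne_top α p
  have hGlim : ∀ z, Tendsto (fun n => G n z - D n z) atTop
      (𝓝 (2 ^ p * (‖h z‖ₑ ^ p * gaussianWeight α p z + ‖h z‖ₑ ^ p * gaussianWeight α p z))) := by
    intro z
    have h1 : Tendsto (fun n => h (r n • z)) atTop (𝓝 (h z)) := by
      have : Tendsto (fun n => r n • z) atTop (𝓝 z) := by simpa using hlim.smul_const z
      exact (hh.tendsto z).comp this
    have h2 : Tendsto (fun n => ‖h (r n • z)‖ₑ ^ p * gaussianWeight α p z) atTop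
        (𝓝 (‖h z‖ₑ ^ p * gaussianWeight α p z)) :=
      ENNReal.Tendsto.mul_const ((ENNReal.continuous_rpow_const.tendsto _).comp h1.enorm)
        (Or.inr (hwt z))
    have h3 : Tendsto (fun n => D n z) atTop (𝓝 0) := by
      have h4 : Tendsto (fun n => h z - h (r n • z)) atTop (𝓝 0) := by
        simpa using (tendsto_const_nhds (x := h z)).sub h1
      have h5 : Tendsto (fun n => ‖h z - h (r n • z)‖ₑ ^ p) atTop (𝓝 0) := by
        simpa [hp, Function.comp_def] using
          (ENNReal.continuous_rpow_const (y := p)).tendsto _ |>.comp h4.enorm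
      simpa [D] using ENNReal.Tendsto.mul_const h5 (Or.inr (hwt z))
    have h6 := ENNReal.Tendsto.sub (ENNReal.Tendsto.const_mul (a := 2 ^ p)
      ((tendsto_const_nhds (x := ‖h z‖ₑ ^ p * gaussianWeight α p z)).add h2)
        (Or.inr (by finiteness))) h3 (Or.inr ENNReal.zero_ne_top)
    simpa [G] using h6
  -- Fatou for the nonnegative functions `G n - D n`, whose pointwise limit is that of `G n` because
  -- `D n → 0`.
  have hfatou : 2 ^ p * (M + M) ≤ liminf (fun n => ∫⁻ z, (G n z - D n z)) atTop := by
    refine le_trans (le_of_eq ?_) (lintegral_liminf_le fun n => (hGmeas n).sub (hDmeas n))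
    rw [lintegral_congr fun z => (hGlim z).liminf_eq, lintegral_const_mul' _ _ (by finiteness),
      lintegral_add_left (measurable_fockMoment_integrand α p hh)]
    rfl
  have hsum : ∀ n, (∫⁻ z, D n z) + ∫⁻ z, (G n z - D n z)
      ≤ 2 ^ p * (M + ENNReal.ofReal (r n ^ 2)⁻¹ * M) := by
    intro n
    rw [← lintegral_add_left (hDmeas n),
      lintegral_congr fun z => add_tsub_cancel_of_le (hDG n z),
      lintegral_const_mul' _ _ (by finiteness),
      lintegral_add_left (measurable_fockMoment_integrand α p hh)]
    gcongr
    · exact le_rfl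
    · exact fockMoment_comp_smul_le hα hp.le hh (hr n) (hr1 n)
  have hclim : Tendsto (fun n => 2 ^ p * (M + ENNReal.ofReal (r n ^ 2)⁻¹ * M)) atTop
      (𝓝 (2 ^ p * (M + M))) := by
    have h1 : Tendsto (fun n => ENNReal.ofReal (r n ^ 2)⁻¹) atTop (𝓝 1) := by
      have : Tendsto (fun n => (r n ^ 2)⁻¹) atTop (𝓝 1) := by
        simpa using (hlim.pow 2).inv₀ (by norm_num)
      simpa using ENNReal.tendsto_ofReal this
    have h2 := ENNReal.Tendsto.mul_const (b := M) h1 (Or.inr hM)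
    rw [one_mul] at h2
    exact ENNReal.Tendsto.const_mul (tendsto_const_nhds.add h2) (Or.inr (by finiteness))
  rw [ENNReal.tendsto_nhds_zero]
  intro ε hε
  set g := 2 ^ p * (M + M)
  have hg : g ≠ ∞ := by finiteness
  have hε2 : 0 < ε / 2 := ENNReal.half_pos hε.ne'
  have h1 : ∀ᶠ n in atTop, 2 ^ p * (M + ENNReal.ofReal (r n ^ 2)⁻¹ * M) ≤ g + ε / 2 :=
    hclim.eventually_le_const (ENNReal.lt_add_right hg hε2.ne')
  have h2 : ∀ᶠ n in atTop, g ≤ (∫⁻ z, (G n z - D n z)) + ε / 2 := by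
    rcases eq_or_ne g 0 with h0 | h0
    · simp [h0]
    · have := eventually_lt_of_lt_liminf ((ENNReal.sub_lt_self hg h0 hε2.ne').trans_le hfatou)
      filter_upwards [this] with n hn
      exact tsub_le_iff_right.1 hn.le
  filter_upwards [h1, h2] with n hn1 hn2
  -- Finiteness allows `∫ (G n - D n)` to be cancelled from both sides in `ℝ≥0∞`.
  have hHfin : ∫⁻ z, (G n z - D n z) ≠ ∞ := by
    refine ne_top_of_le_ne_top (?_ : 2 ^ p * (M + ENNReal.ofReal (r n ^ 2)⁻¹ * M) ≠ ∞)
      (le_add_self.trans (hsum n))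
    finiteness
  refine (ENNReal.add_le_add_iff_right hHfin).1 ?_
  change (∫⁻ z, D n z) + _ ≤ _
  calc (∫⁻ z, D n z) + ∫⁻ z, (G n z - D n z) ≤ g + ε / 2 := (hsum n).trans hn1
    _ ≤ (∫⁻ z, (G n z - D n z)) + ε / 2 + ε / 2 := by gcongr
    _ = _ := by rw [add_assoc, ENNReal.add_halves, add_comm]

end Moment

/-! ### Growth of entire functions with finite moment and density of polynomials -/

section Entire

variable {E : Type*} [NormedAddCommGroup E] [NormedSpace ℂ E] [CompleteSpace E]

/-- Entire functions with finite Gaussian moment have Gaussian growth. -/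
theorem exists_norm_le_of_fockMoment_ne_top {α p : ℝ} (hα : 0 ≤ α) (hp : 0 < p) {h : ℂ → E}
    (hh : Differentiable ℂ h) (hM : fockMoment α p h ≠ ∞) :
    ∃ C, 0 ≤ C ∧ ∀ z, ‖h z‖ ≤ C * Real.exp (α / 2 * (‖z‖ + 1) ^ 2) := by
  obtain ⟨K, hK⟩ := exists_norm_rpow_le_setLIntegral_ball (E := E) hp
  obtain ⟨A, hA⟩ : ∃ A, A = (ENNReal.ofReal K * fockMoment α p h).toReal := ⟨_, rfl⟩
  have hA0 : 0 ≤ A := by rw [hA]; positivity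
  refine ⟨A ^ (1 / p), by positivity, fun z => ?_⟩
  -- On the unit disc around `z` the weight is at least `exp(-αp(‖z‖+1)²/2)`, so inserting it costs
  -- the inverse factor.
  have h1 : ∫⁻ w in ball z 1, ‖h w‖ₑ ^ p
      ≤ ENNReal.ofReal (Real.exp (α * p / 2 * (‖z‖ + 1) ^ 2)) * fockMoment α p h := by
    calc ∫⁻ w in ball z 1, ‖h w‖ₑ ^ p
        ≤ ∫⁻ w in ball z 1, ENNReal.ofReal (Real.exp (α * p / 2 * (‖z‖ + 1) ^ 2)) *
            (‖h w‖ₑ ^ p * gaussianWeight α p w) := by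
          refine setLIntegral_mono' measurableSet_ball fun w hw => ?_
          have hw1 : ‖w‖ ≤ ‖z‖ + 1 := by
            have : ‖w - z‖ < 1 := by simpa [dist_eq_norm] using hw
            linarith [norm_le_norm_add_norm_sub' w z]
          have hw2 : ‖w‖ ^ 2 ≤ (‖z‖ + 1) ^ 2 := by gcongr
          rw [mul_left_comm, gaussianWeight, ← ENNReal.ofReal_mul (by positivity), ← Real.exp_add]
          refine le_mul_of_one_le_right' ?_
          rw [ENNReal.one_le_ofReal, Real.one_le_exp_iff]
          have : 0 ≤ α * p / 2 := by positivity
          nlinarith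
      _ = ENNReal.ofReal (Real.exp (α * p / 2 * (‖z‖ + 1) ^ 2)) *
            ∫⁻ w in ball z 1, ‖h w‖ₑ ^ p * gaussianWeight α p w :=
          lintegral_const_mul' _ _ (by finiteness)
      _ ≤ _ := by
          gcongr
          exact setLIntegral_le_lintegral _ _
  have h2 : ‖h z‖ₑ ^ p ≤ ENNReal.ofReal (Real.exp (α * p / 2 * (‖z‖ + 1) ^ 2) * A) := by
    rw [ENNReal.ofReal_mul (by positivity), hA, ENNReal.ofReal_toReal (by finiteness),
      mul_left_comm]
    exact (hK hh z).trans (by gcongr)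
  rw [← ofReal_norm, ENNReal.ofReal_rpow_of_nonneg (norm_nonneg _) hp.le,
    ENNReal.ofReal_le_ofReal_iff (by positivity)] at h2
  refine (Real.rpow_le_rpow_iff (norm_nonneg _) (by positivity) hp).1 (h2.trans_eq ?_)
  rw [Real.mul_rpow (by positivity) (by positivity), ← Real.rpow_mul hA0, one_div_mul_cancel hp.ne',
    ← Real.exp_mul, Real.rpow_one, mul_comm]
  ring_nf

/-- Taylor polynomials of a strict dilation of an entire function with finite Gaussian moment
converge to the dilation in Gaussian moments. -/
theorem tendsto_fockMoment_sub_taylor {α p : ℝ} (hα : 0 < α) (hp : 0 < p) {h : ℂ → E}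
    (hh : Differentiable ℂ h) (hM : fockMoment α p h ≠ ∞) {r : ℝ} (hr : 0 < r) (hr1 : r < 1) :
    ∃ c : ℕ → E, Tendsto (fun m => fockMoment α p
      ((fun z => h (r • z)) - fun z => ∑ n ∈ Finset.range m, z ^ n • c n)) atTop (𝓝 0) := by
  obtain ⟨C, hC, hgrowth⟩ := exists_norm_le_of_fockMoment_ne_top hα.le hp hh hM
  obtain ⟨a, hsum, hcauchy⟩ := exists_hasSum_pow_smul hh
  -- Cauchy's estimate on the circle of radius `s * ‖z‖`: `r < s` makes the Taylor terms geometric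
  -- with ratio `r / s`, and `s < 1` keeps the growth below the critical rate.
  obtain ⟨s, hrs, hs1⟩ := exists_between hr1
  have hs : 0 < s := hr.trans hrs
  -- Half of the room below `1`, so that `s ^ 2 + t < 1`; the term `t * ‖z‖ ^ 2` absorbs the cross
  -- term of `(s * ‖z‖ + 1) ^ 2`.
  have ht : 0 < (1 - s ^ 2) / 2 := by nlinarith
  obtain ⟨t, htdef⟩ : ∃ t, t = (1 - s ^ 2) / 2 := ⟨_, rfl⟩
  rw [← htdef] at ht
  have hq : r / s < 1 := (div_lt_one hs).2 hrs
  have hq0 : 0 ≤ r / s := by positivity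
  have h1q : 0 < 1 - r / s := sub_pos.2 hq
  let C' := C * Real.exp (α / 2 * (s ^ 2 / t + 1)) * (1 - r / s)⁻¹
  have hbound : ∀ z : ℂ, ∀ w : ℂ, ‖w‖ = s * ‖z‖ →
      ‖h w‖ ≤ C * Real.exp (α / 2 * (s ^ 2 / t + 1))
        * Real.exp (α * (s ^ 2 + t) / 2 * ‖z‖ ^ 2) := by
    intro z w hw
    refine (hgrowth w).trans ?_
    rw [mul_assoc, ← Real.exp_add, hw]
    gcongr
    have h1 : 2 * s * ‖z‖ ≤ t * ‖z‖ ^ 2 + s ^ 2 / t := by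
      have : 0 ≤ (t * ‖z‖ - s) ^ 2 / t := by positivity
      have h2 : (t * ‖z‖ - s) ^ 2 / t = t * ‖z‖ ^ 2 + s ^ 2 / t - 2 * s * ‖z‖ := by
        field_simp; ring
      linarith
    have h3 : (s * ‖z‖ + 1) ^ 2 ≤ (s ^ 2 / t + 1) + (s ^ 2 + t) * ‖z‖ ^ 2 := by nlinarith
    calc α / 2 * (s * ‖z‖ + 1) ^ 2 ≤ α / 2 * ((s ^ 2 / t + 1) + (s ^ 2 + t) * ‖z‖ ^ 2) := by gcongr
      _ = _ := by ring
  refine ⟨fun n => ((r : ℂ) ^ n) • a n, tendsto_fockMoment_sub_of_norm_le (C := C')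
    (β := α * (s ^ 2 + t)) ?_ hp (by positivity) (fun n => by fun_prop) ?_ ?_ ?_⟩
  · rw [htdef]; nlinarith
  · exact hh.continuous.comp (continuous_const_smul r)
  · intro m z
    set X := C * Real.exp (α / 2 * (s ^ 2 / t + 1)) * Real.exp (α * (s ^ 2 + t) / 2 * ‖z‖ ^ 2)
      with hX
    have hX0 : 0 ≤ X := by positivity
    calc ‖∑ n ∈ Finset.range m, z ^ n • (r : ℂ) ^ n • a n‖
        ≤ ∑ n ∈ Finset.range m, ‖z ^ n • (r : ℂ) ^ n • a n‖ := norm_sum_le _ _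
      _ ≤ ∑ n ∈ Finset.range m, (r / s) ^ n * X := by
          refine Finset.sum_le_sum fun n _ => ?_
          have := hcauchy (s * ‖z‖) X (by positivity) (hbound z) n
          calc ‖z ^ n • (r : ℂ) ^ n • a n‖ = (r / s) ^ n * (‖a n‖ * (s * ‖z‖) ^ n) := by
                rw [norm_smul, norm_smul, norm_pow, norm_pow, Complex.norm_real,
                  Real.norm_of_nonneg hr.le, div_pow, mul_pow]
                field_simp
            _ ≤ _ := by gcongr
      _ = (∑ n ∈ Finset.range m, (r / s) ^ n) * X := by rw [Finset.sum_mul]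
      _ ≤ (1 - r / s)⁻¹ * X := by
          gcongr
          rw [← tsum_geometric_of_lt_one hq0 hq]
          exact (summable_geometric_of_lt_one hq0 hq).sum_le_tsum _ fun n _ => by positivity
      _ = _ := by simp only [hX, C']; ring
  · intro z
    refine ((hsum (r • z)).tendsto_sum_nat).congr fun m => Finset.sum_congr rfl fun n _ => ?_
    rw [Complex.real_smul, mul_pow, mul_comm, mul_smul]

/-- Polynomials are dense among entire functions with finite Gaussian moment. -/
theorem exists_polynomial_fockMoment_sub_lt {α p : ℝ} (hα : 0 < α) (hp : 0 < p) {h : ℂ → E}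
    (hh : Differentiable ℂ h) (hM : fockMoment α p h ≠ ∞) {δ : ℝ≥0∞} (hδ : 0 < δ) :
    ∃ (m : ℕ) (c : ℕ → E),
      fockMoment α p (h - fun z => ∑ n ∈ Finset.range m, z ^ n • c n) < δ := by
  have hcont := hh.continuous
  obtain ⟨η, hη, hηδ⟩ := exists_pos_two_rpow_mul_add_le p hδ
  have hr := tendsto_fockMoment_sub_comp_smul hα.le hp hcont hM
    (r := fun n : ℕ => (n + 1 : ℝ) / (n + 2)) (fun n => by positivity)
    (fun n => by rw [div_le_one (by positivity)]; linarith) (by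
      have : Tendsto (fun n : ℕ => 1 - 1 / ((n + 1 : ℕ) + 1 : ℝ)) atTop (𝓝 (1 - 0)) :=
        tendsto_const_nhds.sub
          ((tendsto_add_atTop_iff_nat 1).2 tendsto_one_div_add_atTop_nhds_zero_nat)
      rw [sub_zero] at this
      refine this.congr fun n => ?_
      push_cast
      field_simp
      ring)
  obtain ⟨N, hN⟩ := (hr.eventually_lt_const hη).exists
  obtain ⟨c, hc⟩ := tendsto_fockMoment_sub_taylor hα hp hh hM
    (r := (N + 1 : ℝ) / (N + 2)) (by positivity)
    (by rw [div_lt_one (by positivity)]; linarith)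
  obtain ⟨m, hm⟩ := (hc.eventually_lt_const hη).exists
  refine ⟨m, c, ?_⟩
  set u : ℂ → E := fun z => h (((N + 1 : ℝ) / (N + 2)) • z)
  have hu : Continuous u := hcont.comp (continuous_const_smul _)
  have hsplit : h - (fun z => ∑ n ∈ Finset.range m, z ^ n • c n)
      = (h - u) + (u - fun z => ∑ n ∈ Finset.range m, z ^ n • c n) := by abel
  rw [hsplit]
  exact fockMoment_add_lt hp.le (hcont.sub hu) hηδ hN hm

end Entire

/-! ### Slices of `ℍ`, power series and the representation formula -/

section Slice

variable {I J : ℍ[ℝ]}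

theorem imagUnits_normSq (hI : I ∈ imagUnits) : Quaternion.normSq I = 1 := by
  rw [Quaternion.normSq_eq_norm_mul_self, hI.2, one_mul]

theorem imagUnits_mul_self (hI : I ∈ imagUnits) : I * I = -1 := by
  have h1 : star I = -I := Quaternion.star_eq_neg.2 hI.1
  have h2 := Quaternion.self_mul_star I
  rw [h1, imagUnits_normSq hI, mul_neg, Quaternion.coe_one] at h2
  rw [← h2, neg_neg]

theorem imagUnits_nonempty : imagUnits.Nonempty := by
  obtain ⟨q, h0, h1, h2, h3⟩ : ∃ q : ℍ[ℝ], q.re = 0 ∧ q.imI = 1 ∧ q.imJ = 0 ∧ q.imK = 0 :=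
    ⟨⟨0, 1, 0, 0⟩, rfl, rfl, rfl, rfl⟩
  refine ⟨q, h0, ?_⟩
  have h := Quaternion.normSq_eq_norm_mul_self q
  rw [Quaternion.normSq_def', h0, h1, h2, h3] at h
  nlinarith [norm_nonneg q]

/-- The embedding `x + i y ↦ x + I y` of `ℂ` onto the slice `ℂ_I`. -/
noncomputable def sliceHom (I : ℍ[ℝ]) (hI : I ∈ imagUnits) : ℂ →ₐ[ℝ] ℍ[ℝ] :=
  Complex.liftAux I (imagUnits_mul_self hI)

theorem sliceHom_apply (hI : I ∈ imagUnits) (z : ℂ) :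
    sliceHom I hI z = slicePoint I z.re z.im := by
  rw [sliceHom, Complex.liftAux_apply, slicePoint, Quaternion.mul_coe_eq_smul]
  rfl

theorem sliceHom_eq_add (hI : I ∈ imagUnits) (z : ℂ) :
    sliceHom I hI z = (z.re : ℍ[ℝ]) + z.im • I := by
  rw [sliceHom_apply, slicePoint, Quaternion.mul_coe_eq_smul]

theorem sliceHom_ofReal (hI : I ∈ imagUnits) (x : ℝ) : sliceHom I hI x = (x : ℍ[ℝ]) := by
  simp

theorem sliceHom_I (hI : I ∈ imagUnits) : sliceHom I hI Complex.I = I := by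
  simp [sliceHom_eq_add]

theorem norm_sliceHom (hI : I ∈ imagUnits) (z : ℂ) : ‖sliceHom I hI z‖ = ‖z‖ := by
  have h1 : Quaternion.normSq (sliceHom I hI z) = Complex.normSq z := by
    have h2 := imagUnits_normSq hI
    have h3 := hI.1
    rw [Quaternion.normSq_def'] at h2 ⊢
    rw [sliceHom_eq_add, Complex.normSq_apply]
    simp [h3] at h2 ⊢
    linear_combination (z.im ^ 2) * h2
  rw [Quaternion.normSq_eq_norm_mul_self, Complex.normSq_eq_norm_sq, ← sq] at h1
  exact (pow_left_inj₀ (norm_nonneg _) (norm_nonneg _) two_ne_zero).1 h1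

theorem continuous_sliceHom (hI : I ∈ imagUnits) : Continuous (sliceHom I hI) :=
  (sliceHom I hI).toLinearMap.continuous_of_finiteDimensional

theorem exists_sliceHom_eq (q : ℍ[ℝ]) : ∃ (I : ℍ[ℝ]) (hI : I ∈ imagUnits) (z : ℂ),
    sliceHom I hI z = q := by
  rcases eq_or_ne q.im 0 with h | h
  · obtain ⟨I, hI⟩ := imagUnits_nonempty
    refine ⟨I, hI, q.re, ?_⟩
    rw [sliceHom_ofReal]
    conv_rhs => rw [← Quaternion.re_add_im q, h, add_zero]
  · have h' : ‖q.im‖ ≠ 0 := norm_ne_zero_iff.2 h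
    have hI : ‖q.im‖⁻¹ • q.im ∈ imagUnits :=
      ⟨by simp, by rw [norm_smul, norm_inv, norm_norm, inv_mul_cancel₀ h']⟩
    refine ⟨_, hI, ⟨q.re, ‖q.im‖⟩, ?_⟩
    rw [sliceHom_eq_add, smul_smul, mul_inv_cancel₀ h', one_smul, Quaternion.re_add_im]

/-- The complex structure on `ℍ` given by left multiplication with elements of the slice `ℂ_I`. -/
noncomputable abbrev sliceNormedSpace (I : ℍ[ℝ]) (hI : I ∈ imagUnits) : NormedSpace ℂ ℍ[ℝ] :=
  { Module.compHom ℍ[ℝ] (sliceHom I hI).toRingHom with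
    norm_smul_le := fun z q => by
      change ‖sliceHom I hI z * q‖ ≤ _
      rw [norm_mul, norm_sliceHom] }

theorem slice_smul_def (hI : I ∈ imagUnits) (z : ℂ) (q : ℍ[ℝ]) :
    letI := sliceNormedSpace I hI
    z • q = sliceHom I hI z * q := rfl

/-- The real-linear map `z ↦ (x + I y) c`. -/
noncomputable def sliceMulRight (I : ℍ[ℝ]) (hI : I ∈ imagUnits) (c : ℍ[ℝ]) : ℂ →L[ℝ] ℍ[ℝ] :=
  LinearMap.toContinuousLinearMap
    ((LinearMap.mulRight ℝ c).comp (sliceHom I hI).toLinearMap)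

theorem sliceMulRight_apply (hI : I ∈ imagUnits) (c : ℍ[ℝ]) (z : ℂ) :
    sliceMulRight I hI c z = sliceHom I hI z * c := rfl

/-- Both sides unfold to the same little-o condition: complex differentiability means that the real
derivative is left `ℂ_I`-multiplication applied to `c`. -/
theorem hasDerivAt_slice_iff (hI : I ∈ imagUnits) {h : ℂ → ℍ[ℝ]} {c : ℍ[ℝ]} {z : ℂ} :
    (letI := sliceNormedSpace I hI
     HasDerivAt h c z) ↔ HasFDerivAt h (sliceMulRight I hI c) z := by
  let := sliceNormedSpace I hI
  rw [hasFDerivAt_iff_isLittleO]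
  exact hasDerivAt_iff_isLittleO (𝕜 := ℂ) (F := ℍ[ℝ])

theorem hasDerivAt_re_slice {h : ℂ → ℍ[ℝ]} {L : ℂ →L[ℝ] ℍ[ℝ]} {x y : ℝ}
    (hL : HasFDerivAt h L ⟨x, y⟩) : HasDerivAt (fun t : ℝ => h ⟨t, y⟩) (L 1) x := by
  have h1 : HasDerivAt (fun t : ℝ => (⟨t, y⟩ : ℂ)) 1 x := by
    have := (Complex.ofRealCLM.hasDerivAt (x := x)).add_const (Complex.I * y)
    refine (this.congr_deriv (by simp)).congr_of_eventuallyEq (Eventually.of_forall fun t => ?_)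
    apply Complex.ext <;> simp
  exact hL.comp_hasDerivAt x h1

theorem hasDerivAt_im_slice {h : ℂ → ℍ[ℝ]} {L : ℂ →L[ℝ] ℍ[ℝ]} {x y : ℝ}
    (hL : HasFDerivAt h L ⟨x, y⟩) : HasDerivAt (fun t : ℝ => h ⟨x, t⟩) (L Complex.I) y := by
  have h1 : HasDerivAt (fun t : ℝ => (⟨x, t⟩ : ℂ)) Complex.I y := by
    have := ((Complex.ofRealCLM.hasDerivAt (x := y)).const_mul Complex.I).const_add (x : ℂ)
    refine (this.congr_deriv (by simp)).congr_of_eventuallyEq (Eventually.of_forall fun t => ?_)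
    apply Complex.ext <;> simp
  exact hL.comp_hasDerivAt y h1

/-- A slice regular function is holomorphic on each slice for the slice complex structure. -/
theorem IsSliceRegularOn.differentiable_slice {f : ℍ[ℝ] → ℍ[ℝ]} (hf : IsSliceRegularOn f Set.univ)
    (hI : I ∈ imagUnits) :
    letI := sliceNormedSpace I hI
    Differentiable ℂ fun z => f (sliceHom I hI z) := by
  let := sliceNormedSpace I hI
  intro z
  have hφ : DifferentiableAt ℝ (sliceHom I hI) z :=
    (LinearMap.toContinuousLinearMap (sliceHom I hI).toLinearMap).differentiableAt
  have h1 : DifferentiableAt ℝ (fun z => f (sliceHom I hI z)) z :=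
    (hf.1 (sliceHom I hI z) trivial).comp z hφ
  obtain ⟨L, hL⟩ := h1
  have hx := (hasDerivAt_re_slice hL).deriv
  have hy := (hasDerivAt_im_slice hL).deriv
  have hcr := hf.2 I hI z.re z.im trivial
  simp only [sliceHom_apply] at hx hy
  rw [hx, hy, smul_eq_zero_iff_right (by norm_num)] at hcr
  -- The Cauchy-Riemann equation multiplied by `I`; it makes `L` linear over `ℂ_I`.
  have hLI : L Complex.I = I * L 1 := by
    have : I * (L 1 + I * L Complex.I) = 0 := by rw [hcr, mul_zero]
    rw [mul_add, ← mul_assoc, imagUnits_mul_self hI, neg_one_mul, ← sub_eq_add_neg,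
      sub_eq_zero] at this
    exact this.symm
  refine ((hasDerivAt_slice_iff hI (c := L 1)).2 (hL.congr_fderiv ?_)).differentiableAt
  refine ContinuousLinearMap.ext fun w => ?_
  have hw : w = w.re • (1 : ℂ) + w.im • Complex.I := by
    apply Complex.ext <;> simp
  conv_lhs => rw [hw]
  rw [map_add, map_smul, map_smul, hLI, sliceMulRight_apply, sliceHom_eq_add, add_mul,
    smul_mul_assoc, Quaternion.coe_mul_eq_smul]

/-- The slices share the real axis, so this uniqueness forces the Taylor coefficients found on
different slices to agree. -/
theorem eq_of_hasSum_real_pow {a b : ℕ → ℍ[ℝ]} {g : ℝ → ℍ[ℝ]}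
    (ha : ∀ x, HasSum (fun n => x ^ n • a n) (g x)) (hb : ∀ x, HasSum (fun n => x ^ n • b n) (g x)) :
    a = b := by
  have key : ∀ c : ℕ → ℍ[ℝ], (∀ x, HasSum (fun n => x ^ n • c n) (g x)) →
      HasFPowerSeriesAt g (fun n => ContinuousMultilinearMap.mkPiRing ℝ (Fin n) (c n)) 0 := by
    intro c hc
    refine hasFPowerSeriesAt_iff.2 (Eventually.of_forall fun x => ?_)
    simpa [FormalMultilinearSeries.coeff] using hc x
  have := (key a ha).eq_formalMultilinearSeries (key b hb)
  funext n
  have h2 := congrArg (fun p => FormalMultilinearSeries.coeff p n) this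
  simpa [FormalMultilinearSeries.coeff] using h2

/-- Entire slice regular functions have a global power series expansion. -/
theorem IsSliceRegularOn.exists_hasSum {f : ℍ[ℝ] → ℍ[ℝ]} (hf : IsSliceRegularOn f Set.univ) :
    ∃ a : ℕ → ℍ[ℝ], ∀ q, HasSum (fun n => q ^ n * a n) (f q) := by
  have key : ∀ (I : ℍ[ℝ]) (hI : I ∈ imagUnits), ∃ a : ℕ → ℍ[ℝ],
      ∀ z, HasSum (fun n => sliceHom I hI z ^ n * a n) (f (sliceHom I hI z)) := by
    intro I hI
    let := sliceNormedSpace I hI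
    obtain ⟨a, ha, -⟩ := exists_hasSum_pow_smul (hf.differentiable_slice hI)
    refine ⟨a, fun z => (ha z).congr_fun fun n => ?_⟩
    rw [slice_smul_def, map_pow]
  have hreal : ∀ (I : ℍ[ℝ]) (hI : I ∈ imagUnits) (a : ℕ → ℍ[ℝ]),
      (∀ z, HasSum (fun n => sliceHom I hI z ^ n * a n) (f (sliceHom I hI z))) →
      ∀ x : ℝ, HasSum (fun n => x ^ n • a n) (f x) := by
    intro I hI a ha x
    have := ha x
    rw [sliceHom_ofReal] at this
    refine this.congr_fun fun n => ?_
    rw [← Quaternion.coe_pow, Quaternion.coe_mul_eq_smul]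
  obtain ⟨I₀, hI₀⟩ := imagUnits_nonempty
  obtain ⟨a, ha⟩ := key I₀ hI₀
  refine ⟨a, fun q => ?_⟩
  obtain ⟨I, hI, z, rfl⟩ := exists_sliceHom_eq q
  obtain ⟨b, hb⟩ := key I hI
  rw [eq_of_hasSum_real_pow (g := fun x => f x) (hreal I₀ hI₀ a ha) (hreal I hI b hb)]
  exact hb z

/-- Evaluate at the real quaternion `R`; in finite dimension summability is absolute. -/
theorem summable_norm_mul_pow_of_hasSum {f : ℍ[ℝ] → ℍ[ℝ]} {a : ℕ → ℍ[ℝ]}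
    (ha : ∀ q, HasSum (fun n => q ^ n * a n) (f q)) (R : ℝ) : Summable fun n => ‖a n‖ * R ^ n := by
  refine Summable.of_norm ((summable_norm_iff.2 (ha R).summable).congr fun n => ?_)
  simp [mul_comm]

theorem isSliceRegularOn_of_hasSum {f : ℍ[ℝ] → ℍ[ℝ]} {a : ℕ → ℍ[ℝ]}
    (ha : ∀ q, HasSum (fun n => q ^ n * a n) (f q)) : IsSliceRegularOn f Set.univ := by
  have hs := summable_norm_mul_pow_of_hasSum ha
  constructor
  -- The multilinear terms `(q₁, …, qₙ) ↦ q₁ ⋯ qₙ aₙ` handle noncommutativity and give real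
  -- analyticity on all of `ℍ`.
  · let P : FormalMultilinearSeries ℝ ℍ[ℝ] ℍ[ℝ] := fun n =>
      ((ContinuousLinearMap.mul ℝ ℍ[ℝ]).flip (a n)).compContinuousMultilinearMap
        (ContinuousMultilinearMap.mkPiAlgebraFin ℝ n ℍ[ℝ])
    have hP : ∀ n, ‖P n‖ ≤ ‖a n‖ := fun n => by
      refine (ContinuousLinearMap.norm_compContinuousMultilinearMap_le _ _).trans ?_
      rw [ContinuousMultilinearMap.norm_mkPiAlgebraFin, mul_one]
      refine ContinuousLinearMap.opNorm_le_bound _ (norm_nonneg _) fun q => ?_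
      rw [ContinuousLinearMap.flip_apply, ContinuousLinearMap.mul_apply', norm_mul, mul_comm]
    have hrad : P.radius = ∞ := by
      refine FormalMultilinearSeries.radius_eq_top_of_summable_norm _ fun r => ?_
      exact Summable.of_nonneg_of_le (fun n => by positivity)
        (fun n => by gcongr; exact hP n) (hs r)
    have hfps : HasFPowerSeriesOnBall f P 0 ∞ :=
      { r_le := hrad.ge
        r_pos := ENNReal.zero_lt_top
        hasSum := fun {y} _ => by
          rw [zero_add]
          refine (ha y).congr_fun fun n => ?_
          simp [P] }
    intro q _
    exact (hfps.analyticAt_of_mem (by simp)).differentiableAt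
  · intro I hI x y _
    let := sliceNormedSpace I hI
    have hd : Differentiable ℂ fun z => f (sliceHom I hI z) := by
      have h : (fun z => f (sliceHom I hI z)) = fun z => ∑' n, z ^ n • a n := by
        funext z
        rw [← (ha _).tsum_eq]
        exact tsum_congr fun n => by rw [slice_smul_def, map_pow]
      rw [h]
      exact differentiable_tsum_pow_smul hs
    have h1 := (hasDerivAt_slice_iff hI).1 (hd ⟨x, y⟩).hasDerivAt
    have hx := (hasDerivAt_re_slice h1).deriv
    have hy := (hasDerivAt_im_slice h1).deriv
    simp only [sliceHom_apply] at hx hy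
    rw [hx, hy, sliceMulRight_apply, sliceMulRight_apply, map_one, one_mul, sliceHom_I,
      ← mul_assoc, imagUnits_mul_self hI, neg_one_mul, add_neg_cancel, smul_zero]

theorem IsSliceRegularOn.continuous {f : ℍ[ℝ] → ℍ[ℝ]} (hf : IsSliceRegularOn f Set.univ) :
    Continuous f :=
  continuous_iff_continuousAt.2 fun q => (hf.1 q trivial).continuousAt

theorem IsSliceRegularOn.sub_univ {f g : ℍ[ℝ] → ℍ[ℝ]} (hf : IsSliceRegularOn f Set.univ)
    (hg : IsSliceRegularOn g Set.univ) : IsSliceRegularOn (f - g) Set.univ := by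
  obtain ⟨a, ha⟩ := hf.exists_hasSum
  obtain ⟨b, hb⟩ := hg.exists_hasSum
  exact isSliceRegularOn_of_hasSum (a := a - b) fun q =>
    ((ha q).sub (hb q)).congr_fun fun n => by simp [mul_sub]

/-- The representation formula: the values on one slice determine those on any other slice. -/
theorem IsSliceRegularOn.apply_sliceHom {f : ℍ[ℝ] → ℍ[ℝ]} (hf : IsSliceRegularOn f Set.univ)
    (hI : I ∈ imagUnits) (hJ : J ∈ imagUnits) (z : ℂ) :
    f (sliceHom I hI z) = (1 / 2 : ℝ) •
      (f (sliceHom J hJ z) + f (sliceHom J hJ (starRingEnd ℂ z))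
        - I * J * (f (sliceHom J hJ z) - f (sliceHom J hJ (starRingEnd ℂ z)))) := by
  obtain ⟨a, ha⟩ := hf.exists_hasSum
  have h1 := ha (sliceHom J hJ z)
  have h2 := ha (sliceHom J hJ (starRingEnd ℂ z))
  refine (ha (sliceHom I hI z)).unique
    ((((h1.add h2).sub ((h1.sub h2).mul_left (I * J))).const_smul (1 / 2 : ℝ)).congr_fun
      fun n => ?_)
  simp only [← map_pow]
  set w := z ^ n
  have hJJ := imagUnits_mul_self hJ
  -- It is enough to treat powers `w = z ^ n`: conjugation commutes with powers, and the identity is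
  -- real-linear in `w`. The coefficient `a n` stays on the right throughout.
  have h3 : sliceHom I hI w = (1 / 2 : ℝ) • (sliceHom J hJ w + sliceHom J hJ (starRingEnd ℂ w)
      - I * J * (sliceHom J hJ w - sliceHom J hJ (starRingEnd ℂ w))) := by
    simp only [sliceHom_eq_add, Complex.conj_re, Complex.conj_im, neg_smul]
    have h4 : (w.re : ℍ[ℝ]) + w.im • J - (w.re + -(w.im • J)) = (2 * w.im) • J := by
      rw [mul_smul, two_smul]; abel
    have h5 : (w.re : ℍ[ℝ]) + w.im • J + (w.re + -(w.im • J)) = (2 : ℝ) • (w.re : ℍ[ℝ]) := by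
      rw [two_smul]; abel
    rw [h4, h5, mul_smul_comm, mul_assoc, hJJ, mul_neg_one, smul_neg, sub_neg_eq_add, smul_add,
      smul_smul, smul_smul]
    norm_num
    congr 2
    ring
  rw [h3, smul_mul_assoc, sub_mul, add_mul, mul_assoc, sub_mul]

theorem fockMoment_comp_conj {E : Type*} [NormedAddCommGroup E] (α p : ℝ) (h : ℂ → E) :
    fockMoment α p (fun z => h (starRingEnd ℂ z)) = fockMoment α p h := by
  have := (Complex.conjLIE.measurePreserving).lintegral_comp_emb
    Complex.conjLIE.toHomeomorph.measurableEmbedding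
    (fun z => ‖h z‖ₑ ^ p * gaussianWeight α p z)
  simpa [fockMoment, gaussianWeight] using this

/-- The Gaussian moments of a slice regular function on different slices are comparable. -/
theorem IsSliceRegularOn.fockMoment_sliceHom_le {f : ℍ[ℝ] → ℍ[ℝ]}
    (hf : IsSliceRegularOn f Set.univ) (hI : I ∈ imagUnits) (hJ : J ∈ imagUnits) (α : ℝ) {p : ℝ}
    (hp : 0 ≤ p) :
    fockMoment α p (fun z => f (sliceHom I hI z)) ≤
      2 ^ p * (fockMoment α p (fun z => f (sliceHom J hJ z))
        + fockMoment α p (fun z => f (sliceHom J hJ z))) := by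
  have h := fockMoment_le_of_enorm_le α hp (h := fun z => f (sliceHom I hI z))
    (u := fun z => f (sliceHom J hJ z)) (v := fun z => f (sliceHom J hJ (starRingEnd ℂ z)))
    (hf.continuous.comp (continuous_sliceHom hJ)) (fun z => ?_)
  · rwa [fockMoment_comp_conj α p fun z => f (sliceHom J hJ z)] at h
  · simp only [← ofReal_norm]
    rw [← ENNReal.ofReal_add (norm_nonneg _) (norm_nonneg _)]
    refine ENNReal.ofReal_le_ofReal ?_
    rw [hf.apply_sliceHom hI hJ z, norm_smul]
    set A := f (sliceHom J hJ z)
    set B := f (sliceHom J hJ (starRingEnd ℂ z))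
    have h1 : ‖I * J * (A - B)‖ = ‖A - B‖ := by rw [norm_mul, norm_mul, hI.2, hJ.2]; simp
    have h2 := norm_sub_le (A + B) (I * J * (A - B))
    rw [h1] at h2
    have h3 := norm_add_le A B
    have h4 := norm_sub_le A B
    norm_num
    linarith

theorem sliceNorm_eq (α : ℝ) {p : ℝ} (hI : I ∈ imagUnits) (hp : 0 ≤ p) (f : ℍ[ℝ] → ℍ[ℝ]) :
    sliceNorm α p I f = (ENNReal.ofReal (α * p / (2 * Real.pi)) *
      fockMoment α p (fun z => f (sliceHom I hI z))) ^ (1 / p) := by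
  unfold sliceNorm fockMoment
  congr 2
  refine lintegral_congr fun z => ?_
  rw [← sliceHom_apply hI, ENNReal.ofReal_mul (by positivity), ← ofReal_norm,
    ENNReal.ofReal_rpow_of_nonneg (norm_nonneg _) hp, gaussianWeight, norm_sliceHom,
    ← Real.exp_mul]
  ring_nf

end Slice

/-! ### Kernel combinations and their density -/

theorem hasSum_kernel_mul (α : ℝ) (r q b : ℍ[ℝ]) :
    HasSum (fun n : ℕ => r ^ n * ((α ^ n / (n.factorial : ℝ)) • (star q ^ n * b)))
      (kernel α r q * b) := by
  refine ((summable_norm_kernel α r q).of_norm.hasSum.mul_right b).congr_fun fun n => ?_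
  rw [mul_smul_comm, smul_mul_assoc, mul_assoc]

theorem isSliceRegularOn_of_mem_kernelSpan {α : ℝ} {g : ℍ[ℝ] → ℍ[ℝ]} (hg : g ∈ kernelSpan α) :
    IsSliceRegularOn g Set.univ := by
  obtain ⟨n, q, b, rfl⟩ := hg
  refine isSliceRegularOn_of_hasSum
    (a := fun m => ∑ k, (α ^ m / (m.factorial : ℝ)) • (star (q k) ^ m * b k)) fun r => ?_
  refine (hasSum_sum fun k _ => hasSum_kernel_mul α r (q k) (b k)).congr_fun fun m => ?_
  rw [Finset.mul_sum]

theorem norm_kernel_le {α : ℝ} (hα : 0 ≤ α) (r q : ℍ[ℝ]) :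
    ‖kernel α r q‖ ≤ Real.exp (α * ‖q‖ * ‖r‖) := by
  have h : HasSum (fun k : ℕ => (α * ‖q‖ * ‖r‖) ^ k / (k.factorial : ℝ))
      (Real.exp (α * ‖q‖ * ‖r‖)) := by
    rw [Real.exp_eq_exp_ℝ]
    exact NormedSpace.expSeries_div_hasSum_exp _
  refine tsum_of_norm_bounded h fun k => le_of_eq ?_
  rw [norm_smul, norm_mul, norm_pow, norm_pow, norm_star, norm_div, norm_pow,
    Real.norm_of_nonneg hα, Real.norm_natCast, mul_pow, mul_pow]
  ring

/-- Completing the square: exponential type is absorbed by a Gaussian of arbitrarily small rate. It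
is used with rate `α / 2`. -/
theorem exp_mul_le_exp_mul_sq (c : ℝ) {β : ℝ} (hβ : 0 < β) (x : ℝ) :
    Real.exp (c * x) ≤ Real.exp (c ^ 2 / (2 * β)) * Real.exp (β / 2 * x ^ 2) := by
  rw [← Real.exp_add, Real.exp_le_exp]
  have h1 : 0 ≤ (β * x - c) ^ 2 / (2 * β) := by positivity
  have h2 : (β * x - c) ^ 2 / (2 * β) = c ^ 2 / (2 * β) + β / 2 * x ^ 2 - c * x := by
    field_simp; ring
  linarith

theorem fockMoment_kernelSpan_ne_top {α p : ℝ} (hα : 0 < α) (hp : 0 < p) {g : ℍ[ℝ] → ℍ[ℝ]}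
    (hg : g ∈ kernelSpan α) {I : ℍ[ℝ]} (hI : I ∈ imagUnits) :
    fockMoment α p (fun z => g (sliceHom I hI z)) ≠ ∞ := by
  obtain ⟨n, q, b, rfl⟩ := hg
  refine fockMoment_ne_top_of_norm_le (half_lt_self hα) hp
    (C := ∑ k, Real.exp ((α * ‖q k‖) ^ 2 / (2 * (α / 2))) * ‖b k‖) (by positivity) fun z => ?_
  refine (norm_sum_le _ _).trans ?_
  rw [Finset.sum_mul]
  refine Finset.sum_le_sum fun k _ => ?_
  rw [norm_mul, mul_right_comm]
  gcongr
  refine (norm_kernel_le hα.le _ _).trans ?_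
  rw [norm_sliceHom]
  exact exp_mul_le_exp_mul_sq _ (half_pos hα) _

theorem kernelSpan_subset_fockSpace {α p : ℝ} (hα : 0 < α) (hp : 0 < p) :
    kernelSpan α ⊆ fockSpace α p := by
  intro g hg
  obtain ⟨I, hI⟩ := imagUnits_nonempty
  refine ⟨isSliceRegularOn_of_mem_kernelSpan hg, I, hI, ?_⟩
  rw [sliceNorm_eq α hI hp.le]
  exact ENNReal.rpow_lt_top_of_nonneg (by positivity)
    (ENNReal.mul_ne_top (by finiteness) (fockMoment_kernelSpan_ne_top hα hp hg hI))

theorem zero_mem_kernelSpan (α : ℝ) : (0 : ℍ[ℝ] → ℍ[ℝ]) ∈ kernelSpan α :=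
  ⟨0, ![], ![], by funext r; simp⟩

theorem add_mem_kernelSpan {α : ℝ} {f g : ℍ[ℝ] → ℍ[ℝ]} (hf : f ∈ kernelSpan α)
    (hg : g ∈ kernelSpan α) : f + g ∈ kernelSpan α := by
  obtain ⟨m, q, b, rfl⟩ := hf
  obtain ⟨n, q', b', rfl⟩ := hg
  refine ⟨m + n, Fin.append q q', Fin.append b b', ?_⟩
  funext r
  simp [Fin.sum_univ_add]

/-- At real nodes the kernel is an exponential. -/
theorem kernel_sliceHom_coe (α : ℝ) {I : ℍ[ℝ]} (hI : I ∈ imagUnits) (z : ℂ) (t : ℝ) :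
    kernel α (sliceHom I hI z) (t : ℍ[ℝ]) = sliceHom I hI (Complex.exp ((α * t : ℝ) * z)) := by
  have h : HasSum (fun k : ℕ => ((α * t : ℝ) * z) ^ k / (k.factorial : ℂ))
      (Complex.exp ((α * t : ℝ) * z)) := by
    rw [Complex.exp_eq_exp_ℂ]
    exact NormedSpace.expSeries_div_hasSum_exp _
  have h2 := h.map (sliceHom I hI) (continuous_sliceHom hI)
  rw [← h2.tsum_eq, kernel]
  refine tsum_congr fun k => ?_
  have h3 : ((α * t : ℝ) * z) ^ k / (k.factorial : ℂ)
      = (α ^ k / (k.factorial : ℝ)) • (z ^ k * ((t ^ k : ℝ) : ℂ)) := by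
    rw [Complex.real_smul]
    push_cast
    ring
  rw [Function.comp_apply, h3, map_smul, map_mul, map_pow, sliceHom_ofReal]
  simp

theorem exists_mem_kernelSpan_sliceHom (α : ℝ) {I : ℍ[ℝ]} (hI : I ∈ imagUnits) (n : ℕ)
    (b : ℍ[ℝ]) (s : ℝ) : ∃ g ∈ kernelSpan α, ∀ z,
      g (sliceHom I hI z) =
        sliceHom I hI ((((α * s : ℝ) : ℂ)⁻¹ * (Complex.exp ((α * s : ℝ) * z) - 1)) ^ n) * b := by
  -- The nodes `0, s, …, n s` and signed binomial coefficients come from expanding the `n`-th power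
  -- of the difference quotient.
  refine ⟨_, ⟨n + 1, fun k => (((k : ℕ) * s : ℝ) : ℍ[ℝ]), fun k =>
    ((α * s)⁻¹ ^ n * ((-1) ^ (n - k) * (n.choose k : ℝ))) • b, rfl⟩, fun z => ?_⟩
  have h1 : (((α * s : ℝ) : ℂ)⁻¹ * (Complex.exp ((α * s : ℝ) * z) - 1)) ^ n =
      ∑ k ∈ Finset.range (n + 1), ((α * s)⁻¹ ^ n * ((-1) ^ (n - k) * (n.choose k : ℝ))) •
        Complex.exp ((α * (k * s) : ℝ) * z) := by
    rw [mul_pow, sub_eq_add_neg, add_pow, Finset.mul_sum]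
    refine Finset.sum_congr rfl fun k _ => ?_
    rw [← Complex.exp_nat_mul, Complex.real_smul]
    push_cast
    rw [show (k : ℂ) * (α * s * z) = α * (k * s) * z by ring]
    ring
  rw [h1, map_sum, Finset.sum_mul, Finset.sum_range]
  refine Finset.sum_congr rfl fun k _ => ?_
  rw [kernel_sliceHom_coe, map_smul, mul_smul_comm, smul_mul_assoc]

theorem tendsto_exp_sub_one_div (z : ℂ) {t : ℕ → ℝ} (ht : ∀ m, 0 < t m)
    (hlim : Tendsto t atTop (𝓝 0)) :
    Tendsto (fun m => ((t m : ℝ) : ℂ)⁻¹ * (Complex.exp (t m * z) - 1)) atTop (𝓝 z) := by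
  have h1 : HasDerivAt (fun w : ℂ => Complex.exp (w * z)) z 0 := by
    simpa using ((hasDerivAt_id (0 : ℂ)).mul_const z).cexp
  have h2 := hasDerivAt_iff_tendsto_slope_zero.1 h1
  have h3 : Tendsto (fun m => ((t m : ℝ) : ℂ)) atTop (𝓝[≠] 0) := by
    refine tendsto_nhdsWithin_iff.2 ⟨?_, Eventually.of_forall fun m => ?_⟩
    · simpa [Function.comp_def] using (Complex.continuous_ofReal.tendsto 0).comp hlim
    · simpa using (ht m).ne'
  simpa [Function.comp_def] using h2.comp h3

/-- From `‖e^w - 1‖ ≤ ‖w‖ e^‖w‖` and `‖z‖ ≤ e^‖z‖`. The bound is uniform in `t ≤ A` and its powers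
keep exponential type, as dominated convergence requires. -/
theorem norm_exp_sub_one_div_le (z : ℂ) {t A : ℝ} (ht : 0 < t) (htA : t ≤ A) :
    ‖((t : ℝ) : ℂ)⁻¹ * (Complex.exp (t * z) - 1)‖ ≤ Real.exp ((1 + A) * ‖z‖) := by
  have h1 := Complex.norm_exp_sub_sum_le_norm_mul_exp (t * z) 1
  simp only [Finset.range_one, Finset.sum_singleton, pow_zero, Nat.factorial_zero, Nat.cast_one,
    div_one, pow_one, norm_mul, Complex.norm_real, Real.norm_of_nonneg ht.le] at h1
  rw [norm_mul, norm_inv, Complex.norm_real, Real.norm_of_nonneg ht.le]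
  calc t⁻¹ * ‖Complex.exp (t * z) - 1‖ ≤ t⁻¹ * (t * ‖z‖ * Real.exp (t * ‖z‖)) := by gcongr
    _ = ‖z‖ * Real.exp (t * ‖z‖) := by field_simp
    _ ≤ Real.exp ‖z‖ * Real.exp (A * ‖z‖) := by
        gcongr
        linarith [Real.add_one_le_exp ‖z‖]
    _ = _ := by rw [← Real.exp_add]; ring_nf

/-- Monomials are limits of kernel combinations: finite differences of exponentials at real
nodes. -/
theorem exists_kernelSpan_monomial {α p : ℝ} (hα : 0 < α) (hp : 0 < p) {I : ℍ[ℝ]}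
    (hI : I ∈ imagUnits) (n : ℕ) (b : ℍ[ℝ]) {δ : ℝ≥0∞} (hδ : 0 < δ) :
    ∃ g ∈ kernelSpan α, fockMoment α p
      ((fun z => sliceHom I hI z ^ n * b) - fun z => g (sliceHom I hI z)) < δ := by
  let t : ℕ → ℝ := fun m => α * (1 / (m + 1))
  have ht : ∀ m, 0 < t m := fun m => by positivity
  have htα : ∀ m, t m ≤ α := fun m => by
    refine mul_le_of_le_one_right hα.le ?_
    rw [div_le_one (by positivity)]
    linarith [(Nat.cast_nonneg m : (0 : ℝ) ≤ m)]
  have htlim : Tendsto t atTop (𝓝 0) := by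
    simpa [t] using (tendsto_one_div_add_atTop_nhds_zero_nat (𝕜 := ℝ)).const_mul α
  have hφ := continuous_sliceHom hI
  have hlim := tendsto_fockMoment_sub_of_norm_le (α := α) (p := p) (half_lt_self hα) hp
    (C := Real.exp ((n * (1 + α)) ^ 2 / (2 * (α / 2))) * ‖b‖) (by positivity)
    (u := fun m z => sliceHom I hI (((t m : ℂ)⁻¹ * (Complex.exp (t m * z) - 1)) ^ n) * b)
    (h := fun z => sliceHom I hI z ^ n * b)
    (fun m => (hφ.comp (by fun_prop)).mul continuous_const)
    ((hφ.pow n).mul continuous_const) (fun m z => ?_) (fun z => ?_)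
  · obtain ⟨m, hm⟩ := (hlim.eventually_lt_const hδ).exists
    obtain ⟨g, hg, hgz⟩ := exists_mem_kernelSpan_sliceHom α hI n b (1 / (m + 1))
    refine ⟨g, hg, ?_⟩
    simp only [hgz]
    exact hm
  · rw [norm_mul, norm_sliceHom, norm_pow, mul_right_comm]
    gcongr
    refine (pow_le_pow_left₀ (norm_nonneg _) (norm_exp_sub_one_div_le z (ht m) (htα m)) n).trans ?_
    rw [← Real.exp_nat_mul, ← mul_assoc]
    exact exp_mul_le_exp_mul_sq _ (half_pos hα) _
  · rw [← map_pow]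
    exact ((hφ.tendsto _).comp ((tendsto_exp_sub_one_div z ht htlim).pow n)).mul_const b

theorem exists_kernelSpan_polynomial {α p : ℝ} (hα : 0 < α) (hp : 0 < p) {I : ℍ[ℝ]}
    (hI : I ∈ imagUnits) (m : ℕ) (c : ℕ → ℍ[ℝ]) : ∀ {δ : ℝ≥0∞}, 0 < δ →
    ∃ g ∈ kernelSpan α, fockMoment α p ((fun z => ∑ n ∈ Finset.range m, sliceHom I hI z ^ n * c n)
      - fun z => g (sliceHom I hI z)) < δ := by
  have hφ := continuous_sliceHom hI
  induction m with
  | zero =>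
    intro δ hδ
    refine ⟨0, zero_mem_kernelSpan α, ?_⟩
    simpa [fockMoment, hp] using hδ
  | succ m ih =>
    intro δ hδ
    obtain ⟨η, hη, hηδ⟩ := exists_pos_two_rpow_mul_add_le p hδ
    obtain ⟨g₁, hg₁, h₁⟩ := ih hη
    obtain ⟨g₂, hg₂, h₂⟩ := exists_kernelSpan_monomial (p := p) hα hp hI m (c m) hη
    refine ⟨g₁ + g₂, add_mem_kernelSpan hg₁ hg₂, ?_⟩
    have hc₁ := (isSliceRegularOn_of_mem_kernelSpan hg₁).continuous.comp hφ
    have hsplit : ((fun z => ∑ n ∈ Finset.range (m + 1), sliceHom I hI z ^ n * c n)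
        - fun z => (g₁ + g₂) (sliceHom I hI z))
        = ((fun z => ∑ n ∈ Finset.range m, sliceHom I hI z ^ n * c n)
            - fun z => g₁ (sliceHom I hI z))
          + ((fun z => sliceHom I hI z ^ m * c m) - fun z => g₂ (sliceHom I hI z)) := by
      funext z
      simp only [Finset.sum_range_succ, Pi.sub_apply, Pi.add_apply]
      abel
    rw [hsplit]
    exact fockMoment_add_lt hp.le ((by fun_prop : Continuous _).sub hc₁) hηδ h₁ h₂

/-- On a fixed slice, the kernel combinations are dense among slice regular functions with finite
Gaussian moment. -/
theorem exists_kernelSpan_fockMoment_sub_lt {α p : ℝ} (hα : 0 < α) (hp : 0 < p) {I : ℍ[ℝ]}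
    (hI : I ∈ imagUnits) {f : ℍ[ℝ] → ℍ[ℝ]} (hf : IsSliceRegularOn f Set.univ)
    (hM : fockMoment α p (fun z => f (sliceHom I hI z)) ≠ ∞) {δ : ℝ≥0∞} (hδ : 0 < δ) :
    ∃ g ∈ kernelSpan α, fockMoment α p (fun z => (f - g) (sliceHom I hI z)) < δ := by
  have hφ := continuous_sliceHom hI
  obtain ⟨η, hη, hηδ⟩ := exists_pos_two_rpow_mul_add_le p hδ
  obtain ⟨m, c, hc⟩ : ∃ (m : ℕ) (c : ℕ → ℍ[ℝ]), fockMoment α p ((fun z => f (sliceHom I hI z))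
      - fun z => ∑ n ∈ Finset.range m, sliceHom I hI z ^ n * c n) < η := by
    let := sliceNormedSpace I hI
    obtain ⟨m, c, hc⟩ := exists_polynomial_fockMoment_sub_lt hα hp (hf.differentiable_slice hI) hM hη
    refine ⟨m, c, ?_⟩
    simpa only [slice_smul_def, map_pow] using hc
  obtain ⟨g, hg, hgc⟩ := exists_kernelSpan_polynomial (p := p) hα hp hI m c hη
  refine ⟨g, hg, ?_⟩
  have hsplit : (fun z => (f - g) (sliceHom I hI z))
      = ((fun z => f (sliceHom I hI z))
          - fun z => ∑ n ∈ Finset.range m, sliceHom I hI z ^ n * c n)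
        + ((fun z => ∑ n ∈ Finset.range m, sliceHom I hI z ^ n * c n)
          - fun z => g (sliceHom I hI z)) := by
    funext z
    simp
  rw [hsplit]
  exact fockMoment_add_lt hp.le ((hf.continuous.comp hφ).sub (by fun_prop)) hηδ hc hgc

/-- The comparison constant between slices does not depend on the target slice, so smallness on
`ℂ_I` passes to the supremum. -/
theorem exists_pos_forall_fockMoment_lt_fockNorm_lt {α p : ℝ} (hp : 0 < p) {I : ℍ[ℝ]}
    (hI : I ∈ imagUnits) {ε : ℝ≥0∞} (hε : 0 < ε) : ∃ δ : ℝ≥0∞, 0 < δ ∧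
      ∀ f : ℍ[ℝ] → ℍ[ℝ], IsSliceRegularOn f Set.univ →
        fockMoment α p (fun z => f (sliceHom I hI z)) < δ → fockNorm α p f < ε := by
  -- A supremum only inherits `≤`; the intermediate `ε'` recovers the strict inequality and is
  -- finite.
  obtain ⟨ε', hε', hε'ε⟩ := exists_between hε
  obtain ⟨η, hη, hηε⟩ : ∃ η : ℝ≥0∞, 0 < η ∧ ENNReal.ofReal (α * p / (2 * Real.pi)) * η ≤ ε' ^ p := by
    have hpos : 0 < ε' ^ p := ENNReal.rpow_pos hε' hε'ε.ne_top
    -- The `+ 1` keeps the denominator nonzero, as the sign of `α` is not assumed here.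
    refine ⟨ε' ^ p / (ENNReal.ofReal (α * p / (2 * Real.pi)) + 1),
      ENNReal.div_pos hpos.ne' (by finiteness), ?_⟩
    calc _ ≤ (ENNReal.ofReal (α * p / (2 * Real.pi)) + 1) *
          (ε' ^ p / (ENNReal.ofReal (α * p / (2 * Real.pi)) + 1)) := by
          gcongr
          exact le_self_add
      _ ≤ ε' ^ p := ENNReal.mul_div_le
  obtain ⟨δ, hδ, hδη⟩ := exists_pos_two_rpow_mul_add_le p hη
  refine ⟨δ, hδ, fun f hf hfδ => lt_of_le_of_lt (iSup₂_le fun J hJ => ?_) hε'ε⟩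
  rw [sliceNorm_eq α hJ hp.le]
  calc _ ≤ (ε' ^ p) ^ (1 / p) := by
        gcongr
        refine le_trans ?_ hηε
        gcongr
        refine (hf.fockMoment_sliceHom_le hJ hI α hp.le).trans (le_trans ?_ hδη)
        gcongr
    _ = ε' := by rw [← ENNReal.rpow_mul, mul_one_div_cancel hp.ne', ENNReal.rpow_one]

theorem fockMoment_ne_top_of_sliceNorm_lt_top {α p : ℝ} (hα : 0 < α) (hp : 0 < p) {I : ℍ[ℝ]}
    (hI : I ∈ imagUnits) {f : ℍ[ℝ] → ℍ[ℝ]} (hf : sliceNorm α p I f < ∞) :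
    fockMoment α p (fun z => f (sliceHom I hI z)) ≠ ∞ := by
  intro h
  have hc : 0 < α * p / (2 * Real.pi) := by positivity
  rw [sliceNorm_eq α hI hp.le, h, ENNReal.mul_top (by simpa using hc),
    ENNReal.top_rpow_of_pos (by positivity)] at hf
  exact hf.ne rfl

end SliceFock

theorem theorem4p6 (α p : ℝ) (hα : 0 < α) (hp : 0 < p) :
    SliceFock.kernelSpan α ⊆ SliceFock.fockSpace α p ∧
      ∀ f ∈ SliceFock.fockSpace α p, ∀ ε : ENNReal, 0 < ε →
        ∃ g ∈ SliceFock.kernelSpan α, SliceFock.fockNorm α p (f - g) < ε := by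
  refine ⟨SliceFock.kernelSpan_subset_fockSpace hα hp, ?_⟩
  rintro f ⟨hf, I, hI, hfI⟩ ε hε
  obtain ⟨δ, hδ, hδε⟩ :=
    SliceFock.exists_pos_forall_fockMoment_lt_fockNorm_lt (α := α) hp hI hε
  obtain ⟨g, hg, hgδ⟩ := SliceFock.exists_kernelSpan_fockMoment_sub_lt hα hp hI hf
    (SliceFock.fockMoment_ne_top_of_sliceNorm_lt_top hα hp hI hfI) hδ
  exact ⟨g, hg, hδε _ (hf.sub_univ (SliceFock.isSliceRegularOn_of_mem_kernelSpan hg)) hgδ⟩
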